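/- Let $n\ge 2$, $\alpha>0$, $\beta\ge 0$, $\gamma>0$. There are constants $C>0$, $\eta>0$ and $T>0$, depending only on $n,\alpha,\beta,\gamma$, such that the following holds. Let $\rho_0,v_{01},\dots,v_{0n}$ be real-valued functions in $L^2(\mathbf R^n)$ with $$\|f\|_{1,1}:=\int_{\mathbf R^n}(1+|x|)\,|f(x)|\,dx<\infty\qquad (f=\rho_0,v_{01},\dots,v_{0n}),$$ and let $(\rho,v)$, $v=(v_1,\dots,v_n)$, with $\rho,v_j\in C([0,\infty);L^2(\mathbf R^n))$ real-valued, be the solution of the linearized compressible Navier–Stokes system $$\rho_t+\gamma\,\mathrm{div}\,v=0,\qquad v_t-\alpha\Delta v-\beta\nabla\mathrm{div}\,v+\gamma\nabla\rho=0\qquad (t>0,\ x\in\mathbf R^n),\qquad \rho(0)=\rho_0,\quad v(0)=v_0,$$ where the equations hold for every $t>0$ in the sense of tempered distributions on $\mathbf R^n$. Put $P_0:=\int_{\mathbf R^n}v_0(x)\,dx\in\mathbf R^n$, $Q_0:=\int_{\mathbf R^n}\rho_0(x)\,dx$, write $\|\cdot\|$ for the $L^2(\mathbf R^n)$ norm,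 $\|v_0\|^2=\sum_j\|v_{0j}\|^2$, and let $\hat v(t,\xi)$ be the Fourier transform of $v(t,\cdot)$, normalized on $L^1\cap L^2$ by $\hat f(\xi)=\int_{\mathbf R^n}e^{-ix\cdot\xi}f(x)\,dx$ (and extended to $L^2$). Then for all $t\ge T$ $$\int_{\mathbf R^n}\Big|\hat v(t,\xi)-P_0e^{-\alpha|\xi|^2t}+\frac{\xi(\xi\cdot P_0)}{|\xi|^2}e^{-\alpha|\xi|^2t}+i\xi\,e^{-\frac{(\alpha+\beta)|\xi|^2t}{2}}\frac{\sin(\gamma t|\xi|)}{|\xi|}Q_0-\frac{\xi(\xi\cdot P_0)}{|\xi|^2}e^{-\frac{(\alpha+\beta)|\xi|^2t}{2}}\cos(\gamma t|\xi|)\Big|^2d\xi$$ $$\le C\Big(|P_0|^2+|Q_0|^2+\sum_{j=1}^n\|v_{0j}\|_{1,1}^2+\|\rho_0\|_{1,1}^2\Big)t^{-\frac n2-1}+Ce^{-\eta t}\big(\|v_0\|^2+\|\rho_0\|^2\big).$$ -/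

import Mathlib

open MeasureTheory
open scoped FourierTransform LineDeriv SchwartzMap

noncomputable section

namespace LinNS

/-- The space `ℝⁿ` with its Euclidean norm. -/
abbrev Sp (n : ℕ) : Type := EuclideanSpace ℝ (Fin n)

/-- The space `L²(ℝⁿ)` of real-valued functions. -/
abbrev L2 (n : ℕ) : Type := Lp ℝ 2 (volume : Measure (Sp n))

/-- The partial derivative `∂φ/∂x_j` of a Schwartz function. -/
def pd {n : ℕ} (j : Fin n) (φ : 𝓢(Sp n, ℂ)) : 𝓢(Sp n, ℂ) :=
  ∂_{EuclideanSpace.single j (1 : ℝ)} φ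

/-- The pairing `∫ f(x) φ(x) dx` of an `L²` function with a Schwartz function. -/
def pair {n : ℕ} (f : L2 n) (φ : 𝓢(Sp n, ℂ)) : ℂ :=
  ∫ x, (f x : ℂ) * φ x

/-- `(ρ, v)` is a solution of the Cauchy problem
`ρ_t + γ div v = 0`, `v_t - α Δ v - β ∇ div v + γ ∇ ρ = 0`, `(ρ, v)(0) = (ρ₀, v₀)`:
the curves `ρ, v₁, …, vₙ` are in `C([0,∞); L²(ℝⁿ))`, the initial data are attained, and for
every `t > 0` both equations hold in the sense of tempered distributions on `ℝⁿ`. -/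
structure IsSolution {n : ℕ} (α β γ : ℝ) (ρ₀ : Sp n → ℝ) (v₀ : Fin n → Sp n → ℝ)
    (ρ : ℝ → L2 n) (v : ℝ → Fin n → L2 n) : Prop where
  continuousOn_density : ContinuousOn ρ (Set.Ici 0)
  continuousOn_velocity : ∀ j, ContinuousOn (fun t => v t j) (Set.Ici 0)
  initial_density : ρ 0 =ᵐ[volume] ρ₀
  initial_velocity : ∀ j, v 0 j =ᵐ[volume] v₀ j
  continuity_equation : ∀ t : ℝ, 0 < t → ∀ φ : 𝓢(Sp n, ℂ),
    HasDerivAt (fun s => pair (ρ s) φ) (γ * (∑ k, pair (v t k) (pd k φ))) t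
  momentum_equation : ∀ t : ℝ, 0 < t → ∀ (j : Fin n) (φ : 𝓢(Sp n, ℂ)),
    HasDerivAt (fun s => pair (v s j) φ)
      (α * (∑ k, pair (v t j) (pd k (pd k φ))) + β * (∑ k, pair (v t k) (pd k (pd j φ)))
        + γ * pair (ρ t) (pd j φ)) t

/-- The (Plancherel) Fourier transform on `L²(ℝⁿ)` which on `L¹ ∩ L²` is
`f̂(ξ) = ∫ e^{-i x·ξ} f(x) dx`. It is obtained from Mathlib's transform, whose kernel is
`e^{-2πi x·ξ}`, by rescaling the frequency. -/
def fourierL2 {n : ℕ} (f : L2 n) (ξ : Sp n) : ℂ :=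
  (𝓕 (Complex.ofRealCLM.compLp f : Lp ℂ 2 (volume : Measure (Sp n))) :
    Lp ℂ 2 (volume : Measure (Sp n))) ((2 * Real.pi)⁻¹ • ξ)

/-- Membership in the weighted space `L^{1,1}(ℝⁿ)`. -/
def MemL11 {n : ℕ} (f : Sp n → ℝ) : Prop :=
  Integrable f ∧ Integrable (fun x => (1 + ‖x‖) * |f x|)

/-- The norm `‖f‖_{1,1} = ∫ (1 + |x|) |f(x)| dx`. -/
def norm11 {n : ℕ} (f : Sp n → ℝ) : ℝ := ∫ x, (1 + ‖x‖) * |f x|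

/-- The `L²(ℝⁿ)` norm. -/
def norm2 {n : ℕ} (f : Sp n → ℝ) : ℝ := (eLpNorm f 2 volume).toReal

/-- The `j`-th component of the profile
`P e^{-α|ξ|²t} - (ξ(ξ·P)/|ξ|²) e^{-α|ξ|²t} - iξ e^{-(α+β)|ξ|²t/2} (sin(γt|ξ|)/|ξ|) Q
  + (ξ(ξ·P)/|ξ|²) e^{-(α+β)|ξ|²t/2} cos(γt|ξ|)`, for `ξ ≠ 0`. -/
def profile {n : ℕ} (α β γ : ℝ) (P : Fin n → ℝ) (Q : ℝ) (t : ℝ) (ξ : Sp n) (j : Fin n) : ℂ :=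
  ((P j * Real.exp (-α * ‖ξ‖ ^ 2 * t) : ℝ) : ℂ)
    - ((ξ j * (∑ k, ξ k * P k) / ‖ξ‖ ^ 2 * Real.exp (-α * ‖ξ‖ ^ 2 * t) : ℝ) : ℂ)
    - Complex.I * ((ξ j * Real.exp (-(α + β) * ‖ξ‖ ^ 2 * t / 2)
        * (Real.sin (γ * t * ‖ξ‖) / ‖ξ‖) * Q : ℝ) : ℂ)
    + ((ξ j * (∑ k, ξ k * P k) / ‖ξ‖ ^ 2 * Real.exp (-(α + β) * ‖ξ‖ ^ 2 * t / 2)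
        * Real.cos (γ * t * ‖ξ‖) : ℝ) : ℂ)

/-- The squared Euclidean distance `|v̂(t,ξ) - profile(t,ξ)|²`, where `P₀ⱼ = ∫ v₀ⱼ` and
`Q₀ = ∫ ρ₀`, and `w` stands for `v(t,·)`. -/
def errorSq {n : ℕ} (α β γ : ℝ) (ρ₀ : Sp n → ℝ) (v₀ : Fin n → Sp n → ℝ)
    (w : Fin n → L2 n) (t : ℝ) (ξ : Sp n) : ℝ :=
  ∑ j, ‖fourierL2 (w j) ξ
    - profile α β γ (fun k => ∫ x, v₀ k x) (∫ x, ρ₀ x) t ξ j‖ ^ 2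

end LinNS

end

noncomputable section

/-! ### Linear systems of multipliers in L²: from weak solutions to pointwise ODEs -/

namespace LinNS

open Filter Topology Set
open scoped ENNReal ContDiff

/-- The space `L²(ℝⁿ)` of complex-valued functions. -/
abbrev CL2 (n : ℕ) : Type := Lp ℂ 2 (volume : Measure (Sp n))

variable {n : ℕ}

/-- Multiplication by an essentially bounded function, as an operator on `L²`
(zero if the function is not essentially bounded). -/
def mulOp (m : Sp n → ℂ) : CL2 n →L[ℂ] CL2 n :=
  open Classical in
  if h : MemLp m ∞ volume then
    (ContinuousLinearMap.mul ℂ ℂ).holderL volume ∞ 2 2 (h.toLp m) else 0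

lemma coeFn_mulOp {m : Sp n → ℂ} (h : MemLp m ∞ volume) (f : CL2 n) :
    mulOp m f =ᵐ[volume] fun x => m x * f x := by
  rw [mulOp, dif_pos h, ContinuousLinearMap.holderL_apply_apply]
  filter_upwards [(ContinuousLinearMap.mul ℂ ℂ).coeFn_holder (r := 2) (h.toLp m) f,
    h.coeFn_toLp] with x h1 h2
  rw [h1, h2]
  rfl

/-- The functional `f ↦ ∫ f φ` on `L²` given by a Schwartz function `φ`. -/
def pairL (φ : 𝓢(Sp n, ℂ)) : CL2 n →L[ℂ] ℂ :=
  ((ContinuousLinearMap.mul ℂ ℂ).lpPairing volume 2 2).flip (φ.toLp 2)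

lemma pairL_apply (φ : 𝓢(Sp n, ℂ)) (f : CL2 n) : pairL φ f = ∫ x, f x * φ x := by
  rw [pairL, ContinuousLinearMap.flip_apply, ContinuousLinearMap.lpPairing_eq_integral]
  apply integral_congr_ae
  filter_upwards [φ.coeFn_toLp 2 volume] with x hx
  rw [hx]
  rfl

/-- Schwartz functions separate L², because L² embeds in the tempered distributions. -/
lemma eq_zero_of_forall_pairL_eq_zero {f : CL2 n} (h : ∀ φ, pairL φ f = 0) : f = 0 := by
  have hk := Lp.ker_toTemperedDistributionCLM_eq_bot (F := ℂ) (μ := (volume : Measure (Sp n)))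
    (p := 2)
  rw [LinearMap.ker_eq_bot'] at hk
  refine hk f ?_
  ext φ
  have := h φ
  rw [pairL_apply] at this
  simpa [mul_comm] using this

lemma eq_of_forall_pairL_eq {f g : CL2 n} (h : ∀ φ, pairL φ f = pairL φ g) : f = g := by
  rw [← sub_eq_zero]
  exact eq_zero_of_forall_pairL_eq_zero fun φ => by rw [map_sub, h, sub_self]

/-- A curve in `L²` which is differentiable when tested against Schwartz functions, with
continuous weak derivative, is differentiable in norm. -/
lemma hasDerivAt_of_forall_pairL {f g : ℝ → CL2 n} (hg : ContinuousOn g (Ioi 0))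
    (h : ∀ t, 0 < t → ∀ φ, HasDerivAt (fun s => pairL φ (f s)) (pairL φ (g t)) t)
    {t : ℝ} (ht : 0 < t) : HasDerivAt f (g t) t := by
  have hsub : ∀ s, 0 < s → uIcc t s ⊆ Ioi 0 := fun s hs x hx =>
    lt_of_lt_of_le (lt_min ht hs) hx.1
  -- Tested against each `φ` this is the scalar fundamental theorem of calculus; separation lifts it
  -- to an identity in L², where continuity of `g` allows differentiation in norm.
  have key : ∀ s, 0 < s → f s = f t + ∫ τ in t..s, g τ := by
    intro s hs
    refine eq_of_forall_pairL_eq fun φ => ?_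
    have hgi : IntervalIntegrable g volume t s := (hg.mono (hsub s hs)).intervalIntegrable
    rw [map_add, ← (pairL φ).intervalIntegral_comp_comm hgi,
      intervalIntegral.integral_eq_sub_of_hasDerivAt (f := fun s => pairL φ (f s))
        (fun x hx => h x (hsub s hs hx) φ)
        (((pairL φ).continuous.comp_continuousOn (hg.mono (hsub s hs))).intervalIntegrable)]
    ring
  have hder : HasDerivAt (fun s => ∫ τ in t..s, g τ) (g t) t := by
    apply intervalIntegral.integral_hasDerivAt_right
    · simp
    · exact hg.stronglyMeasurableAtFilter isOpen_Ioi _ ht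
    · exact hg.continuousAt (Ioi_mem_nhds ht)
  refine (hder.const_add (f t)).congr_of_eventuallyEq ?_
  filter_upwards [Ioi_mem_nhds ht] with s hs using key s hs

/-- The solution of `V' = A V` on `(0, ∞)`, continuous at `0`, is `exp (t A) V(0)`. -/
lemma eq_exp_smul_of_hasDerivAt {H : Type*} [NormedAddCommGroup H] [NormedSpace ℝ H]
    [CompleteSpace H] (A : H →L[ℝ] H) {V : ℝ → H} (hc : ContinuousOn V (Ici 0))
    (hd : ∀ t, 0 < t → HasDerivAt V (A (V t)) t) {t : ℝ} (ht : 0 ≤ t) :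
    V t = NormedSpace.exp (t • A) (V 0) := by
  have hE : ∀ s, HasDerivAt (fun s : ℝ => NormedSpace.exp ((t - s) • A))
      (-(NormedSpace.exp ((t - s) • A) * A)) s := by
    intro s
    have h1 : HasDerivAt (fun s : ℝ => t - s) (-1) s := by
      simpa using (hasDerivAt_id s).const_sub t
    have h2 := (hasDerivAt_exp_smul_const (𝕂 := ℝ) A (t - s)).scomp s h1
    rw [neg_one_smul] at h2
    exact h2
  -- `Z` runs from `exp (t A) V(0)` to `V t`, and the two terms of its derivative cancel. The
  -- interior derivative and continuity on the closed interval suffice, so nothing is asked of the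
  -- derivative at `0`.
  set Z : ℝ → H := fun s => NormedSpace.exp ((t - s) • A) (V s) with hZ
  have hZc : ContinuousOn Z (Icc 0 t) := by
    intro s hs
    have h1 : ContinuousWithinAt (fun s : ℝ => NormedSpace.exp ((t - s) • A)) (Icc 0 t) s :=
      (hE s).continuousAt.continuousWithinAt
    exact h1.clm_apply ((hc s hs.1).mono Icc_subset_Ici_self)
  have hZd : ∀ s ∈ Ioo 0 t, HasDerivAt Z 0 s := by
    intro s hs
    have h1 := (hE s).clm_apply (hd s hs.1)
    simpa using h1
  have h0 := intervalIntegral.integral_eq_sub_of_hasDerivAt_of_le ht hZc hZd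
    (by simp)
  simp only [intervalIntegral.integral_zero, hZ, sub_self, zero_smul, sub_zero] at h0
  rw [eq_comm, sub_eq_zero, NormedSpace.exp_zero] at h0
  exact h0

lemma exp_zero_smul_apply {H : Type*} [NormedAddCommGroup H] [NormedSpace ℝ H]
    (A : H →L[ℝ] H) (y : H) : NormedSpace.exp ((0 : ℝ) • A) y = y := by
  rw [zero_smul, NormedSpace.exp_zero]
  rfl

/-- The matrix `m`, as a real-linear operator on `ℂ^I`. -/
def matL {I : Type*} [Fintype I] (m : I → I → ℂ) : (I → ℂ) →L[ℝ] (I → ℂ) :=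
  ContinuousLinearMap.pi fun i =>
    ∑ j, ((ContinuousLinearMap.mul ℂ ℂ (m i j)).restrictScalars ℝ).comp
      (ContinuousLinearMap.proj (R := ℝ) j)

lemma matL_apply {I : Type*} [Fintype I] (m : I → I → ℂ) (y : I → ℂ) (i : I) :
    matL m y i = ∑ j, m i j * y j := by
  simp [matL]

/-- The matrix of multiplication operators given by `m`, as a real-linear operator on `(L²)^I`. -/
def matOp {I : Type*} [Fintype I] (m : I → I → Sp n → ℂ) : (I → CL2 n) →L[ℝ] (I → CL2 n) :=
  ContinuousLinearMap.pi fun i =>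
    ∑ j, ((mulOp (m i j)).restrictScalars ℝ).comp (ContinuousLinearMap.proj (R := ℝ) j)

lemma matOp_apply {I : Type*} [Fintype I] (m : I → I → Sp n → ℂ) (V : I → CL2 n) (i : I) :
    matOp m V i = ∑ j, mulOp (m i j) (V j) := by
  simp [matOp]

lemma coeFn_matOp {I : Type*} [Fintype I] {m : I → I → Sp n → ℂ}
    (hm : ∀ i j, MemLp (m i j) ∞ volume) (V : I → CL2 n) :
    ∀ᵐ x, ∀ i, matOp m V i x = matL (fun i j => m i j x) (fun j => V j x) i := by
  rw [ae_all_iff]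
  intro i
  rw [matOp_apply]
  have h1 : ∀ᵐ x, ∀ j, mulOp (m i j) (V j) x = m i j x * V j x :=
    ae_all_iff.2 fun j => coeFn_mulOp (hm i j) (V j)
  filter_upwards [h1, Lp.coeFn_finsetSum Finset.univ (fun j => mulOp (m i j) (V j))] with x h1 h2
  rw [h2, matL_apply]
  simp [h1]

lemma coeFn_matOp_pow {I : Type*} [Fintype I] {m : I → I → Sp n → ℂ}
    (hm : ∀ i j, MemLp (m i j) ∞ volume) (V : I → CL2 n) (k : ℕ) :
    ∀ᵐ x, ∀ i, (matOp m ^ k) V i x = (matL (fun i j => m i j x) ^ k) (fun j => V j x) i := by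
  induction k with
  | zero => simp
  | succ k ih =>
    filter_upwards [ih, coeFn_matOp hm ((matOp m ^ k) V)] with x h1 h2 i
    rw [pow_succ', pow_succ', mul_apply_eq_comp, mul_apply_eq_comp, h2, funext h1]

/-- The exponential of a matrix of multiplication operators acts pointwise. -/
lemma coeFn_exp_matOp {I : Type*} [Fintype I] {m : I → I → Sp n → ℂ}
    (hm : ∀ i j, MemLp (m i j) ∞ volume) (V : I → CL2 n) (t : ℝ) :
    ∀ᵐ x, ∀ i, (NormedSpace.exp (t • matOp m)) V i x
      = (NormedSpace.exp (t • matL (fun i j => m i j x))) (fun j => V j x) i := by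
  rw [ae_all_iff]
  intro i
  have hsum : ∀ {H : Type _} [NormedAddCommGroup H] [NormedSpace ℝ H] [CompleteSpace H]
      (A : H →L[ℝ] H) (v : H), Tendsto (fun N : ℕ => ∑ k ∈ Finset.range N,
        ((k.factorial : ℝ)⁻¹ * t ^ k) • (A ^ k) v) atTop (𝓝 (NormedSpace.exp (t • A) v)) := by
    intro H _ _ _ A v
    have h1 := (NormedSpace.exp_series_hasSum_exp' (𝕂 := ℝ) (t • A)).tendsto_sum_nat
    have h2 := ((ContinuousLinearMap.apply ℝ H v).continuous.tendsto _).comp h1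
    refine h2.congr fun N => ?_
    simp [smul_pow, smul_smul]
  have hL : Tendsto (fun N : ℕ => ∑ k ∈ Finset.range N,
      ((k.factorial : ℝ)⁻¹ * t ^ k) • (matOp m ^ k) V i) atTop
      (𝓝 (NormedSpace.exp (t • matOp m) V i)) := by
    have := ((continuous_apply i).tendsto _).comp (hsum (matOp m) V)
    refine this.congr fun N => ?_
    simp
  -- Convergence in L² gives almost everywhere convergence only along a subsequence; the pointwise
  -- matrix series converges in full, so the limits agree.
  obtain ⟨ns, hns, hae⟩ := (tendstoInMeasure_of_tendsto_Lp hL).exists_seq_tendsto_ae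
  have hcoe : ∀ᵐ x, ∀ N : ℕ, (∑ k ∈ Finset.range N,
      ((k.factorial : ℝ)⁻¹ * t ^ k) • (matOp m ^ k) V i : CL2 n) x
      = ∑ k ∈ Finset.range N, ((k.factorial : ℝ)⁻¹ * t ^ k) • ((matOp m ^ k) V i) x := by
    rw [ae_all_iff]
    intro N
    have h1 : ∀ᵐ x, ∀ k : ℕ, (((k.factorial : ℝ)⁻¹ * t ^ k) • (matOp m ^ k) V i : CL2 n) x
        = ((k.factorial : ℝ)⁻¹ * t ^ k) • ((matOp m ^ k) V i) x :=
      ae_all_iff.2 fun k => Lp.coeFn_smul _ _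
    filter_upwards [h1, Lp.coeFn_finsetSum (Finset.range N)
      (fun k => ((k.factorial : ℝ)⁻¹ * t ^ k) • (matOp m ^ k) V i)] with x h1 h2
    rw [h2, Finset.sum_apply]
    exact Finset.sum_congr rfl fun k _ => h1 k
  filter_upwards [hae, hcoe, ae_all_iff.2 (coeFn_matOp_pow hm V)] with x h1 h2 h3
  have h4 := ((continuous_apply i).tendsto _).comp
    (hsum (matL (fun i j => m i j x)) (fun j => V j x))
  refine tendsto_nhds_unique h1 ((h4.comp hns.tendsto_atTop).congr fun N => ?_)
  simp only [Function.comp_apply, h2, h3, Finset.sum_apply, Pi.smul_apply]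

lemma pairL_mulOp {m : Sp n → ℂ} (hm : MemLp m ∞ volume) (hm' : m.HasTemperateGrowth)
    (φ : 𝓢(Sp n, ℂ)) (f : CL2 n) :
    pairL φ (mulOp m f) = pairL (SchwartzMap.smulLeftCLM ℂ m φ) f := by
  rw [pairL_apply, pairL_apply]
  apply integral_congr_ae
  filter_upwards [coeFn_mulOp hm f] with x hx
  rw [hx, SchwartzMap.smulLeftCLM_apply_apply hm', smul_eq_mul]
  ring

lemma mulOp_mulOp {a b c : Sp n → ℂ} (ha : MemLp a ∞ volume) (hb : MemLp b ∞ volume)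
    (hc : MemLp c ∞ volume) (h : ∀ x, a x * b x = c x) (f : CL2 n) :
    mulOp a (mulOp b f) = mulOp c f := by
  apply Lp.ext
  filter_upwards [coeFn_mulOp ha (mulOp b f), coeFn_mulOp hb f, coeFn_mulOp hc f] with x h1 h2 h3
  rw [h1, h2, h3, ← h, mul_assoc]

/-- A continuous curve in `(L²)^I` which solves `u' = M(x) u` weakly, with a matrix multiplier `M`
of temperate growth, is almost everywhere a solution of this linear system of ordinary
differential equations with parameter `x`. -/
theorem ae_exists_pointwise_solution {I : Type*} [Fintype I] {m : I → I → Sp n → ℂ}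
    (hm : ∀ i j, (m i j).HasTemperateGrowth) {u : ℝ → I → CL2 n}
    (hc : ∀ i, ContinuousOn (fun t => u t i) (Ici 0))
    (hu : ∀ t, 0 < t → ∀ i φ, HasDerivAt (fun s => pairL φ (u s i))
      (∑ j, pairL (SchwartzMap.smulLeftCLM ℂ (m i j) φ) (u t j)) t) {t : ℝ} (ht : 0 ≤ t) :
    ∀ᵐ x, ∃ y : ℝ → I → ℂ, (∀ i, y 0 i = u 0 i x) ∧ (∀ i, y t i = u t i x) ∧
      ∀ s i, HasDerivAt (fun s => y s i) (∑ j, m i j x * y s j) s := by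
  suffices H : ∀ R : ℕ, ∀ᵐ x, x ∈ Metric.ball (0 : Sp n) R → ∃ y : ℝ → I → ℂ,
      (∀ i, y 0 i = u 0 i x) ∧ (∀ i, y t i = u t i x) ∧
      ∀ s i, HasDerivAt (fun s => y s i) (∑ j, m i j x * y s j) s by
    filter_upwards [ae_all_iff.2 H] with x hx
    obtain ⟨R, hR⟩ := exists_nat_gt ‖x‖
    exact hx R (by simpa using hR)
  intro R
  set B := Metric.ball (0 : Sp n) R with hB
  -- Two cutoffs are needed. The smooth one, equal to 1 on the ball, keeps test functions Schwartz
  -- and makes the multipliers bounded; the idempotent indicator `b` then turns the truncated system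
  -- into a closed one, `V' = A V`.
  let χ : ContDiffBump (0 : Sp n) := ⟨R + 1, R + 2, by positivity, by linarith⟩
  set c : Sp n → ℂ := fun x => (χ x : ℂ) with hcdef
  have hχs : HasCompactSupport c := χ.hasCompactSupport.comp_left (g := ((↑) : ℝ → ℂ)) rfl
  have hχd : ContDiff ℝ ∞ c := Complex.ofRealCLM.contDiff.comp χ.contDiff
  have hχt : c.HasTemperateGrowth := hχs.hasTemperateGrowth hχd
  have hχb : MemLp c ∞ volume := hχd.continuous.memLp_of_hasCompactSupport hχs
  have hmc : ∀ i j, MemLp (m i j * c) ∞ volume := fun i j =>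
    ((hm i j).1.continuous.mul hχd.continuous).memLp_of_hasCompactSupport hχs.mul_left
  set b : Sp n → ℂ := B.indicator 1 with hbdef
  have hbm : Measurable b := measurable_one.indicator measurableSet_ball
  have hbb : MemLp b ∞ volume := by
    refine memLp_top_of_bound hbm.aestronglyMeasurable 1 (.of_forall fun x => ?_)
    by_cases hx : x ∈ B <;> simp [hbdef, hx]
  have hbc : ∀ x, b x * c x = b x := by
    intro x
    by_cases hx : x ∈ B
    · have : χ x = 1 := χ.one_of_mem_closedBall
        (Metric.ball_subset_closedBall (Metric.ball_subset_ball (by simp [χ]) hx))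
      simp [hcdef, this]
    · simp [hbdef, hx]
  have hbsq : ∀ x, b x * b x = b x := fun x => by by_cases hx : x ∈ B <;> simp [hbdef, hx]
  have hbM : ∀ i j, MemLp (fun x => b x * m i j x) ∞ volume := by
    intro i j
    have := (hmc i j).mul (p := ∞) (q := ∞) (r := ∞) hbb
    refine this.congr_norm (hbm.mul (hm i j).1.continuous.measurable).aestronglyMeasurable
      (.of_forall fun x => ?_)
    simp only [Pi.mul_apply]
    rw [mul_left_comm, hbc, mul_comm]
  -- norm differentiability of the smoothly truncated curve
  have hW : ∀ i s, 0 < s → HasDerivAt (fun s => mulOp c (u s i))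
      (∑ j, mulOp (m i j * c) (u s j)) s := by
    intro i s hs
    refine hasDerivAt_of_forall_pairL (g := fun s => ∑ j, mulOp (m i j * c) (u s j)) ?_ ?_ hs
    · exact continuousOn_finsetSum _ fun j _ =>
        (mulOp (m i j * c)).continuous.comp_continuousOn ((hc j).mono Ioi_subset_Ici_self)
    · intro s hs φ
      have := hu s hs i (SchwartzMap.smulLeftCLM ℂ c φ)
      simp only [map_sum, pairL_mulOp hχb hχt, pairL_mulOp (hmc _ _) ((hm _ _).mul hχt)]
      convert this using 3 with j
      rw [SchwartzMap.smulLeftCLM_smulLeftCLM_apply (hm i j) hχt]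
  set V : ℝ → I → CL2 n := fun s i => mulOp b (u s i) with hV
  set A := matOp (fun i j x => b x * m i j x) with hA
  have hVc : ContinuousOn V (Ici 0) := continuousOn_pi.2 fun i =>
    (mulOp b).continuous.comp_continuousOn (hc i)
  have hVd : ∀ s, 0 < s → HasDerivAt V (A (V s)) s := by
    intro s hs
    rw [hasDerivAt_pi]
    intro i
    have h1 := ((mulOp b).restrictScalars ℝ).hasFDerivAt.comp_hasDerivAt s (hW i s hs)
    simp only [ContinuousLinearMap.coe_restrictScalars', map_sum] at h1
    convert h1 using 1
    · funext s
      exact (mulOp_mulOp hbb hχb hbb hbc _).symm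
    · rw [hA, matOp_apply]
      refine Finset.sum_congr rfl fun j _ => ?_
      rw [mulOp_mulOp (hbM i j) hbb (hbM i j), mulOp_mulOp hbb (hmc i j) (hbM i j)]
      · intro x
        simp only [Pi.mul_apply]
        rw [mul_left_comm, hbc, mul_comm]
      · intro x
        rw [mul_right_comm, hbsq]
  have hex := eq_exp_smul_of_hasDerivAt A hVc hVd ht
  have hVx : ∀ s, ∀ᵐ x, ∀ i, V s i x = b x * u s i x := fun s =>
    ae_all_iff.2 fun i => coeFn_mulOp hbb (u s i)
  filter_upwards [coeFn_exp_matOp hbM (V 0) t, hVx 0, hVx t] with x hx h0 h1 hxB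
  have hb1 : b x = 1 := by simp [hbdef, hxB]
  simp only [hb1, one_mul] at h0 h1 hx
  -- Inside the ball `b = 1`, so the truncated matrix at `x` is the full one.
  refine ⟨fun s => NormedSpace.exp (s • matL (fun i j => m i j x)) (fun j => u 0 j x), ?_, ?_, ?_⟩
  · intro i
    exact congrFun (exp_zero_smul_apply _ _) i
  · intro i
    rw [← h1, hex, hx, funext h0]
  · intro s i
    have h2 := (hasDerivAt_exp_smul_const' (𝕂 := ℝ) (matL (fun i j => m i j x)) s).clm_apply
      (hasDerivAt_const s (fun j => u 0 j x))
    have h3 := (hasDerivAt_pi.1 h2) i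
    rw [map_zero, add_zero, mul_apply_eq_comp, matL_apply] at h3
    exact h3

end LinNS

/-! ### Explicit solution of a single Fourier mode -/

namespace LinNS

open Filter Topology Set
open scoped ENNReal

variable {n : ℕ}

/-- `(ρ, v)` solves the Fourier-transformed system at the frequency `ξ`. -/
structure IsModeSolution (α β γ : ℝ) (ξ : Sp n) (ρ : ℝ → ℂ) (v : ℝ → Fin n → ℂ) : Prop where
  density : ∀ s, HasDerivAt ρ (-(Complex.I * γ * ∑ k, ξ k * v s k)) s
  velocity : ∀ s j, HasDerivAt (fun s => v s j)
    (-(α * (‖ξ‖ : ℂ) ^ 2 * v s j) - β * ξ j * (∑ k, ξ k * v s k) - Complex.I * γ * ξ j * ρ s) s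

lemma sum_sq_eq_norm_sq (ξ : Sp n) : ∑ k, ξ k ^ 2 = ‖ξ‖ ^ 2 := by
  rw [EuclideanSpace.norm_sq_eq]
  simp

lemma abs_coord_le_norm (ξ : Sp n) (k : Fin n) : |ξ k| ≤ ‖ξ‖ := by
  simpa using PiLp.norm_apply_le ξ k

lemma eq_exp_mul_of_hasDerivAt {a : ℝ → ℂ} {c : ℝ} (h : ∀ s, HasDerivAt a (c * a s) s) (t : ℝ) :
    a t = Real.exp (c * t) * a 0 := by
  have hd : ∀ s, HasDerivAt (fun s : ℝ => (Real.exp (-(c * s)) : ℂ) * a s) 0 s := by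
    intro s
    have h1 : HasDerivAt (fun s : ℝ => Real.exp (-(c * s))) (Real.exp (-(c * s)) * -(c * 1)) s :=
      (((hasDerivAt_id s).const_mul c).neg).exp
    have := h1.ofReal_comp.mul (h s)
    refine this.congr_deriv ?_
    push_cast
    ring
  have hc := is_const_of_deriv_eq_zero (fun s => (hd s).differentiableAt) (fun s => (hd s).deriv) t 0
  simp only [mul_zero, neg_zero, Real.exp_zero, Complex.ofReal_one, one_mul] at hc
  rw [← hc, ← mul_assoc, ← Complex.ofReal_mul, ← Real.exp_add]
  simp

/-- The solution of the harmonic oscillator `a'' = -ω² a`. -/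
lemma eq_cos_add_sin_of_hasDerivAt {a b : ℝ → ℂ} {ω : ℝ} (hω : ω ≠ 0)
    (ha : ∀ s, HasDerivAt a (b s) s) (hb : ∀ s, HasDerivAt b (-(ω ^ 2 * a s)) s) (t : ℝ) :
    a t = Real.cos (ω * t) * a 0 + Real.sin (ω * t) / ω * b 0 := by
  have hω' : (ω : ℂ) ≠ 0 := by exact_mod_cast hω
  have hl : ∀ s : ℝ, HasDerivAt (fun s : ℝ => ω * s) ω s := fun s => by
    simpa using (hasDerivAt_id s).const_mul ω
  have hcos : ∀ s : ℝ, HasDerivAt (fun s : ℝ => ((Real.cos (ω * s) : ℝ) : ℂ))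
      ((-Real.sin (ω * s) * ω : ℝ) : ℂ) s := fun s => (hl s).cos.ofReal_comp
  have hsin : ∀ s : ℝ, HasDerivAt (fun s : ℝ => ((Real.sin (ω * s) : ℝ) : ℂ))
      ((Real.cos (ω * s) * ω : ℝ) : ℂ) s := fun s => (hl s).sin.ofReal_comp
  -- Rotating `(a, b/ω)` back by the angle `ωs` gives two conserved quantities; the inverse rotation
  -- recovers `a`.
  have h1 : ∀ s, HasDerivAt (fun s : ℝ => (Real.cos (ω * s) : ℂ) * a s
      - Real.sin (ω * s) * b s / ω) 0 s := by
    intro s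
    refine HasDerivAt.congr_deriv (((hcos s).mul (ha s)).sub
      (((hsin s).mul (hb s)).div_const (ω : ℂ))) ?_
    push_cast
    field_simp
    ring
  have h2 : ∀ s, HasDerivAt (fun s : ℝ => (Real.sin (ω * s) : ℂ) * a s
      + Real.cos (ω * s) * b s / ω) 0 s := by
    intro s
    refine HasDerivAt.congr_deriv (((hsin s).mul (ha s)).add
      (((hcos s).mul (hb s)).div_const (ω : ℂ))) ?_
    push_cast
    field_simp
    ring
  have e1 := is_const_of_deriv_eq_zero (fun s => (h1 s).differentiableAt) (fun s => (h1 s).deriv) t 0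
  have e2 := is_const_of_deriv_eq_zero (fun s => (h2 s).differentiableAt) (fun s => (h2 s).deriv) t 0
  simp only [mul_zero, Real.cos_zero, Real.sin_zero, Complex.ofReal_one, one_mul,
    Complex.ofReal_zero, zero_mul, zero_div, sub_zero, zero_add] at e1 e2
  have hpy : (Real.cos (ω * t) : ℂ) ^ 2 + (Real.sin (ω * t) : ℂ) ^ 2 = 1 := by
    exact_mod_cast Real.cos_sq_add_sin_sq (ω * t)
  calc a t = ((Real.cos (ω * t) : ℂ) ^ 2 + (Real.sin (ω * t) : ℂ) ^ 2) * a t := by rw [hpy, one_mul]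
    _ = Real.cos (ω * t) * a 0 + Real.sin (ω * t) * (b 0 / ω) := by
      rw [← e1, ← e2]
      ring
    _ = _ := by ring

namespace IsModeSolution

variable {α β γ : ℝ} {ξ : Sp n} {ρ : ℝ → ℂ} {v : ℝ → Fin n → ℂ}

/-- Contract the velocity equation with `ξ`: since `∑ ξ_k² = |ξ|²`, the two viscous terms merge, and
`ξ·v` and the density form a closed two-dimensional system. -/
lemma longitudinal (h : IsModeSolution α β γ ξ ρ v) (s : ℝ) :
    HasDerivAt (fun s => ∑ k, ξ k * v s k)
      (-((α + β) * (‖ξ‖ : ℂ) ^ 2 * ∑ k, ξ k * v s k) - Complex.I * γ * (‖ξ‖ : ℂ) ^ 2 * ρ s) s := by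
  have h1 := HasDerivAt.fun_sum (u := Finset.univ)
    (fun k _ => (h.velocity s k).const_mul (ξ k : ℂ))
  refine h1.congr_deriv ?_
  have h2 : ∑ k, (ξ k : ℂ) ^ 2 = (‖ξ‖ : ℂ) ^ 2 := by exact_mod_cast sum_sq_eq_norm_sq ξ
  set w := ∑ k, (ξ k : ℂ) * v s k with hw
  have h3 : ∀ k, (ξ k : ℂ) * (-(α * (‖ξ‖ : ℂ) ^ 2 * v s k) - β * ξ k * w
      - Complex.I * γ * ξ k * ρ s) = -(α * (‖ξ‖ : ℂ) ^ 2) * (ξ k * v s k)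
      + (-(β * w) - Complex.I * γ * ρ s) * (ξ k : ℂ) ^ 2 := fun k => by ring
  rw [Finset.sum_congr rfl fun k _ => h3 k, Finset.sum_add_distrib, ← Finset.mul_sum, ← Finset.mul_sum, h2, ← hw]
  ring

/-- The factor `exp (μ s)` with `μ = (α+β)|ξ|²/2` removes the damping, leaving a harmonic oscillator
of frequency `ω`. -/
lemma longitudinal_eq (h : IsModeSolution α β γ ξ ρ v) {ω : ℝ} (hω : ω ≠ 0)
    (hω2 : ω ^ 2 = γ ^ 2 * ‖ξ‖ ^ 2 - (α + β) ^ 2 * ‖ξ‖ ^ 4 / 4) (t : ℝ) :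
    ∑ k, ξ k * v t k = Real.exp (-(α + β) * ‖ξ‖ ^ 2 * t / 2) *
      (Real.cos (ω * t) * (∑ k, ξ k * v 0 k) + Real.sin (ω * t) / ω *
        (-((α + β) * (‖ξ‖ : ℂ) ^ 2 / 2 * ∑ k, ξ k * v 0 k)
          - Complex.I * γ * (‖ξ‖ : ℂ) ^ 2 * ρ 0)) := by
  set w : ℝ → ℂ := fun s => ∑ k, ξ k * v s k with hw
  have hwd : ∀ s, HasDerivAt w (-((α + β) * (‖ξ‖ : ℂ) ^ 2 * w s)
    - Complex.I * γ * (‖ξ‖ : ℂ) ^ 2 * ρ s) s := h.longitudinal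
  have hρd : ∀ s, HasDerivAt ρ (-(Complex.I * γ * w s)) s := h.density
  set μ : ℝ := (α + β) * ‖ξ‖ ^ 2 / 2 with hμ
  have hE : ∀ s : ℝ, HasDerivAt (fun s : ℝ => ((Real.exp (μ * s) : ℝ) : ℂ))
      ((Real.exp (μ * s) * (μ * 1) : ℝ) : ℂ) s := fun s =>
    (((hasDerivAt_id s).const_mul μ).exp).ofReal_comp
  have hω2' : (ω : ℂ) ^ 2 = γ ^ 2 * (‖ξ‖ : ℂ) ^ 2 - (α + β) ^ 2 * (‖ξ‖ : ℂ) ^ 4 / 4 := by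
    exact_mod_cast hω2
  have key := eq_cos_add_sin_of_hasDerivAt (a := fun s => (Real.exp (μ * s) : ℂ) * w s)
    (b := fun s => (Real.exp (μ * s) : ℂ) * (-((α + β) * (‖ξ‖ : ℂ) ^ 2 / 2 * w s)
          - Complex.I * γ * (‖ξ‖ : ℂ) ^ 2 * ρ s)) hω
    (fun s => by
      refine HasDerivAt.congr_deriv ((hE s).mul (hwd s)) ?_
      push_cast [hμ]
      ring)
    (fun s => by
      refine HasDerivAt.congr_deriv ((hE s).mul ((((hwd s).const_mul ((α + β) * (‖ξ‖ : ℂ) ^ 2 / 2)).neg).sub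
        ((hρd s).const_mul (Complex.I * γ * (‖ξ‖ : ℂ) ^ 2)))) ?_
      rw [hω2']
      push_cast [hμ]
      linear_combination (Complex.exp ((α + β) * (‖ξ‖ : ℂ) ^ 2 / 2 * s)) * γ ^ 2 * (‖ξ‖ : ℂ) ^ 2 * w s * Complex.I_sq) t
  simp only [mul_zero, Real.exp_zero, Complex.ofReal_one, one_mul] at key
  rw [← key, ← mul_assoc, ← Complex.ofReal_mul, ← Real.exp_add]
  have : -(α + β) * ‖ξ‖ ^ 2 * t / 2 + μ * t = 0 := by rw [hμ]; ring
  rw [this]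
  simp [hw]

/-- Projection orthogonal to `ξ` kills both gradient terms, so only the heat equation remains. -/
lemma transversal_eq (h : IsModeSolution α β γ ξ ρ v) (hξ : ξ ≠ 0) (t : ℝ) (j : Fin n) :
    v t j - ξ j * (∑ k, ξ k * v t k) / (‖ξ‖ : ℂ) ^ 2 = Real.exp (-α * ‖ξ‖ ^ 2 * t) *
      (v 0 j - ξ j * (∑ k, ξ k * v 0 k) / (‖ξ‖ : ℂ) ^ 2) := by
  have hr : (‖ξ‖ : ℂ) ≠ 0 := by simpa using hξ
  refine eq_exp_mul_of_hasDerivAt (c := -α * ‖ξ‖ ^ 2)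
    (a := fun s => v s j - ξ j * (∑ k, ξ k * v s k) / (‖ξ‖ : ℂ) ^ 2) (fun s => ?_) t
  refine HasDerivAt.congr_deriv ((h.velocity s j).sub (((h.longitudinal s).const_mul (ξ j : ℂ)).div_const
    ((‖ξ‖ : ℂ) ^ 2))) ?_
  push_cast
  field_simp
  ring

end IsModeSolution

end LinNS

/-! ### Low-frequency comparison with the profile -/

namespace LinNS

open Filter Topology Set

variable {n : ℕ}

/-- The low-frequency dispersion relation `ω² = γ²r² - ν²r⁴/4` and its deviation from `γ r`. -/
lemma exists_dispersion {ν γ r : ℝ} (hν : 0 < ν) (hγ : 0 < γ) (hr : 0 < r) (h : ν * r ≤ γ) :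
    ∃ ω : ℝ, γ * r / 2 ≤ ω ∧ ω ^ 2 = γ ^ 2 * r ^ 2 - ν ^ 2 * r ^ 4 / 4 ∧
      |ω - γ * r| ≤ ν ^ 2 / (4 * γ) * r ^ 3 := by
  have h2 : (ν * r) ^ 2 ≤ γ ^ 2 := pow_le_pow_left₀ (by positivity) h 2
  have h4 : ν ^ 2 * r ^ 4 ≤ γ ^ 2 * r ^ 2 := by
    calc ν ^ 2 * r ^ 4 = (ν * r) ^ 2 * r ^ 2 := by ring
      _ ≤ _ := by gcongr
  have hpos : 0 ≤ γ ^ 2 * r ^ 2 - ν ^ 2 * r ^ 4 / 4 := by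
    have : 0 ≤ ν ^ 2 * r ^ 4 := by positivity
    linarith
  set ω := √(γ ^ 2 * r ^ 2 - ν ^ 2 * r ^ 4 / 4) with hω
  have hsq : ω ^ 2 = γ ^ 2 * r ^ 2 - ν ^ 2 * r ^ 4 / 4 := Real.sq_sqrt hpos
  have hω0 : 0 ≤ ω := Real.sqrt_nonneg _
  have hγr : 0 < γ * r := by positivity
  refine ⟨ω, ?_, hsq, ?_⟩
  · refine abs_le_of_sq_le_sq' ?_ hω0 |>.2
    rw [hsq]
    have : 0 ≤ γ ^ 2 * r ^ 2 := by positivity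
    nlinarith
  -- Factor the difference of squares: `(ω - γr)(ω + γr) = -ν²r⁴/4`, with `ω + γr ≥ γr`.
  · have h5 : |ω - γ * r| * (γ * r) ≤ ν ^ 2 * r ^ 4 / 4 := by
      calc |ω - γ * r| * (γ * r) ≤ |ω - γ * r| * (ω + γ * r) := by gcongr; linarith
        _ = |ω - γ * r| * |ω + γ * r| := by rw [abs_of_nonneg (by positivity : 0 ≤ ω + γ * r)]
        _ = |-(ν ^ 2 * r ^ 4 / 4)| := by
          rw [← abs_mul]
          congr 1
          linear_combination hsq
        _ = ν ^ 2 * r ^ 4 / 4 := by rw [abs_neg, abs_of_nonneg (by positivity)]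
    rw [← le_div_iff₀ hγr] at h5
    refine h5.trans (le_of_eq ?_)
    field_simp

/-- Comparison of the damped oscillation of a mode with the undamped one with limiting data. -/
lemma norm_oscillation_sub_le {ν γ r ω t S N Q : ℝ} {w p q : ℂ} (hν : 0 < ν) (hγ : 0 < γ)
    (hr : 0 < r) (hlow : ν * r ≤ γ) (ht : 0 ≤ t) (hS : 0 ≤ S) (hN : 0 ≤ N)
    (hω1 : γ * r / 2 ≤ ω) (hω3 : |ω - γ * r| ≤ ν ^ 2 / (4 * γ) * r ^ 3)
    (hwp : ‖w - p‖ ≤ N * r ^ 2 * S) (hp : ‖p‖ ≤ N * r * S) (hw : ‖w‖ ≤ N * r * S)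
    (hQ : |Q| ≤ S) (hq : ‖q - Q‖ ≤ r * S) :
    ‖Real.cos (ω * t) * w + Real.sin (ω * t) / ω * (-(ν * (r : ℂ) ^ 2 / 2 * w)
        - Complex.I * γ * (r : ℂ) ^ 2 * q) - Real.cos (γ * t * r) * p
        + Complex.I * r * Real.sin (γ * t * r) * Q‖
      ≤ (N + N * (ν ^ 2 / (4 * γ)) + N * ν / γ + 2 + ν / (2 * γ) + ν ^ 2 / (4 * γ))
        * (r ^ 2 * (1 + r ^ 2 * t) * S) := by
  have hω0 : 0 < ω := lt_of_lt_of_le (by positivity) hω1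
  have hωc : (ω : ℂ) ≠ 0 := by exact_mod_cast hω0.ne'
  set A := ν ^ 2 / (4 * γ) with hA
  have hA0 : 0 ≤ A := by positivity
  have hinv : ω⁻¹ ≤ 2 / (γ * r) := by
    rw [inv_le_comm₀ hω0 (by positivity), inv_div]
    exact hω1
  have hdiff : |ω * t - γ * t * r| ≤ A * r ^ 3 * t := by
    rw [show ω * t - γ * t * r = (ω - γ * r) * t by ring, abs_mul, abs_of_nonneg ht]
    gcongr
  have hcosd : ‖((Real.cos (ω * t) - Real.cos (γ * t * r) : ℝ) : ℂ)‖ ≤ A * r ^ 3 * t := by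
    rw [Complex.norm_real]
    exact (Real.abs_cos_sub_cos_le _ _).trans hdiff
  have hsind : ‖((Real.sin (ω * t) - Real.sin (γ * t * r) : ℝ) : ℂ)‖ ≤ A * r ^ 3 * t := by
    rw [Complex.norm_real]
    exact (Real.abs_sin_sub_sin_le _ _).trans hdiff
  have hcos : ‖((Real.cos (ω * t) : ℝ) : ℂ)‖ ≤ 1 := by
    rw [Complex.norm_real]
    exact Real.abs_cos_le_one _
  have hsin : ‖((Real.sin (ω * t) : ℝ) : ℂ)‖ ≤ 1 := by
    rw [Complex.norm_real]
    exact Real.abs_sin_le_one _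
  have hso : ‖((Real.sin (ω * t) / ω : ℝ) : ℂ)‖ ≤ 2 / (γ * r) := by
    rw [Complex.norm_real, Real.norm_eq_abs, abs_div, abs_of_pos hω0, div_eq_mul_inv]
    calc _ ≤ 1 * (2 / (γ * r)) := by gcongr; exact Real.abs_sin_le_one _
      _ = _ := one_mul _
  have hQc : ‖(Q : ℂ)‖ ≤ S := by rwa [Complex.norm_real]
  -- The natural bound is of order `r²`; `ν r ≤ γ` trades one factor `r` for a constant, which is
  -- all that is needed.
  have hrat : ‖((γ * r / ω - 1 : ℝ) : ℂ)‖ ≤ ν / (2 * γ) * r := by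
    rw [Complex.norm_real, Real.norm_eq_abs,
      show γ * r / ω - 1 = -(ω - γ * r) * ω⁻¹ by field_simp; ring, abs_mul, abs_neg,
      abs_of_pos (inv_pos.2 hω0)]
    calc |ω - γ * r| * ω⁻¹ ≤ A * r ^ 3 * (2 / (γ * r)) := by gcongr
      _ = ν * (ν * r) * r / (2 * γ ^ 2) := by rw [hA]; field_simp; ring
      _ ≤ ν * γ * r / (2 * γ ^ 2) := by gcongr
      _ = _ := by field_simp
  have e1 : ‖(Real.cos (ω * t) : ℂ) * (w - p)‖ ≤ N * r ^ 2 * S := by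
    rw [norm_mul]
    calc _ ≤ 1 * (N * r ^ 2 * S) := by gcongr
      _ = _ := one_mul _
  have e2 : ‖((Real.cos (ω * t) - Real.cos (γ * t * r) : ℝ) : ℂ) * p‖
      ≤ A * r ^ 3 * t * (N * r * S) := by
    rw [norm_mul]
    gcongr
  have e3 : ‖((Real.sin (ω * t) / ω : ℝ) : ℂ) * ((ν * r ^ 2 / 2 : ℝ) * w)‖
      ≤ 2 / (γ * r) * (ν * r ^ 2 / 2 * (N * r * S)) := by
    rw [norm_mul, norm_mul, Complex.norm_real (ν * r ^ 2 / 2), Real.norm_eq_abs,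
      abs_of_nonneg (by positivity)]
    gcongr
  have e4 : ‖((Real.sin (ω * t) / ω : ℝ) : ℂ) * ((γ * r ^ 2 : ℝ) * (q - Q))‖
      ≤ 2 / (γ * r) * (γ * r ^ 2 * (r * S)) := by
    rw [norm_mul, norm_mul, Complex.norm_real (γ * r ^ 2), Real.norm_eq_abs,
      abs_of_nonneg (by positivity)]
    gcongr
  have e5 : ‖(r : ℂ) * (((γ * r / ω - 1 : ℝ) : ℂ) * (Real.sin (ω * t) : ℂ) * Q)‖
      ≤ r * (ν / (2 * γ) * r * 1 * S) := by
    rw [norm_mul, norm_mul, norm_mul, Complex.norm_real r, Real.norm_eq_abs, abs_of_pos hr]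
    gcongr
  have e6 : ‖(r : ℂ) * (((Real.sin (ω * t) - Real.sin (γ * t * r) : ℝ) : ℂ) * Q)‖
      ≤ r * (A * r ^ 3 * t * S) := by
    rw [norm_mul, norm_mul, Complex.norm_real r, Real.norm_eq_abs, abs_of_pos hr]
    gcongr
  -- Six errors, each from one change: the data and the phase in the cosine term, the dropped
  -- viscous correction, then the data, the amplitude `γr/ω` and the phase in the sine term.
  have hdec : Real.cos (ω * t) * w + Real.sin (ω * t) / ω * (-(ν * (r : ℂ) ^ 2 / 2 * w)
        - Complex.I * γ * (r : ℂ) ^ 2 * q) - Real.cos (γ * t * r) * p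
        + Complex.I * r * Real.sin (γ * t * r) * Q
      = (Real.cos (ω * t) : ℂ) * (w - p)
        + ((Real.cos (ω * t) - Real.cos (γ * t * r) : ℝ) : ℂ) * p
        - ((Real.sin (ω * t) / ω : ℝ) : ℂ) * ((ν * r ^ 2 / 2 : ℝ) * w)
        - Complex.I * (((Real.sin (ω * t) / ω : ℝ) : ℂ) * ((γ * r ^ 2 : ℝ) * (q - Q))
          + (r : ℂ) * (((γ * r / ω - 1 : ℝ) : ℂ) * (Real.sin (ω * t) : ℂ) * Q)
          + (r : ℂ) * (((Real.sin (ω * t) - Real.sin (γ * t * r) : ℝ) : ℂ) * Q)) := by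
    push_cast
    field_simp
    ring
  rw [hdec]
  refine (norm_sub_le _ _).trans ?_
  rw [norm_mul, Complex.norm_I, one_mul]
  have t1 := norm_sub_le ((Real.cos (ω * t) : ℂ) * (w - p)
        + ((Real.cos (ω * t) - Real.cos (γ * t * r) : ℝ) : ℂ) * p)
        (((Real.sin (ω * t) / ω : ℝ) : ℂ) * ((ν * r ^ 2 / 2 : ℝ) * w))
  have t2 := norm_add_le ((Real.cos (ω * t) : ℂ) * (w - p))
        (((Real.cos (ω * t) - Real.cos (γ * t * r) : ℝ) : ℂ) * p)
  have t3 := norm_add₃_le (a := ((Real.sin (ω * t) / ω : ℝ) : ℂ) * ((γ * r ^ 2 : ℝ) * (q - Q)))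
          (b := (r : ℂ) * (((γ * r / ω - 1 : ℝ) : ℂ) * (Real.sin (ω * t) : ℂ) * Q))
          (c := (r : ℂ) * (((Real.sin (ω * t) - Real.sin (γ * t * r) : ℝ) : ℂ) * Q))
  set x := r ^ 2 * t with hx
  have hx0 : 0 ≤ x := by positivity
  set Y := r ^ 2 * S with hY
  have hY0 : 0 ≤ Y := by positivity
  have f1 : N * r ^ 2 * S = N * Y := by rw [hY]; ring
  have f2 : A * r ^ 3 * t * (N * r * S) = N * A * (x * Y) := by rw [hY, hx]; ring
  have f3 : 2 / (γ * r) * (ν * r ^ 2 / 2 * (N * r * S)) = N * ν / γ * Y := by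
    rw [hY]; field_simp
  have f4 : 2 / (γ * r) * (γ * r ^ 2 * (r * S)) = 2 * Y := by rw [hY]; field_simp
  have f5 : r * (ν / (2 * γ) * r * 1 * S) = ν / (2 * γ) * Y := by rw [hY]; ring
  have f6 : r * (A * r ^ 3 * t * S) = A * (x * Y) := by rw [hY, hx]; ring
  have f7 : r ^ 2 * (1 + x) * S = Y + x * Y := by rw [hY]; ring
  have hxY : 0 ≤ x * Y := by positivity
  -- These nonnegative products are part of the slack from putting all six bounds under the common
  -- weight `1 + r²t`.
  have g1 : 0 ≤ N * A * Y := by positivity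
  have g2 : 0 ≤ A * Y := by positivity
  have g3 : 0 ≤ N * (x * Y) := by positivity
  have g4 : 0 ≤ N * ν / γ * (x * Y) := by positivity
  have g5 : 0 ≤ ν / (2 * γ) * (x * Y) := by positivity
  rw [f7]
  have : (N + N * A + N * ν / γ + 2 + ν / (2 * γ) + A) * (Y + x * Y)
    = N * Y + N * A * (x * Y) + N * ν / γ * Y + (2 * Y + ν / (2 * γ) * Y + A * (x * Y))
      + (N * A * Y + A * Y + N * (x * Y) + N * ν / γ * (x * Y) + ν / (2 * γ) * (x * Y)
        + 2 * (x * Y)) := by ring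
  rw [this]
  linarith

lemma norm_sum_coord_mul_le {ξ : Sp n} {a : Fin n → ℂ} {M : ℝ} (h : ∀ k, ‖a k‖ ≤ M) :
    ‖∑ k, (ξ k : ℂ) * a k‖ ≤ n * (‖ξ‖ * M) := by
  calc ‖∑ k, (ξ k : ℂ) * a k‖ ≤ ∑ k : Fin n, ‖(ξ k : ℂ) * a k‖ := norm_sum_le _ _
    _ ≤ ∑ _k : Fin n, ‖ξ‖ * M := by
      gcongr with k
      rw [norm_mul, Complex.norm_real]
      exact mul_le_mul (abs_coord_le_norm ξ k) (h k) (norm_nonneg _) (norm_nonneg _)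
    _ = _ := by simp

lemma norm_coord_mul_div_le {ξ : Sp n} (hξ : ξ ≠ 0) (j : Fin n) (z : ℂ) :
    ‖(ξ j : ℂ) * z / (‖ξ‖ : ℂ) ^ 2‖ ≤ ‖z‖ / ‖ξ‖ := by
  have hr : 0 < ‖ξ‖ := norm_pos_iff.2 hξ
  rw [norm_div, norm_mul, norm_pow, Complex.norm_real, Complex.norm_real, norm_norm,
    div_le_div_iff₀ (by positivity) hr]
  calc ‖ξ j‖ * ‖z‖ * ‖ξ‖ ≤ ‖ξ‖ * ‖z‖ * ‖ξ‖ := by gcongr; exact abs_coord_le_norm ξ j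
    _ = _ := by ring

/-- The grouping mirrors `transversal_eq` and `longitudinal_eq`, so that solution and profile can be
subtracted part by part. -/
lemma profile_eq {ξ : Sp n} (hξ : ξ ≠ 0) (α β γ : ℝ) (P : Fin n → ℝ) (Q t : ℝ) (j : Fin n) :
    profile α β γ P Q t ξ j = Real.exp (-α * ‖ξ‖ ^ 2 * t) *
        (P j - ξ j * (∑ k, (ξ k : ℂ) * P k) / (‖ξ‖ : ℂ) ^ 2)
      + ξ j * (Real.exp (-(α + β) * ‖ξ‖ ^ 2 * t / 2) *
        (Real.cos (γ * t * ‖ξ‖) * (∑ k, (ξ k : ℂ) * P k)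
          - Complex.I * ‖ξ‖ * Real.sin (γ * t * ‖ξ‖) * Q)) / (‖ξ‖ : ℂ) ^ 2 := by
  have hr : (‖ξ‖ : ℂ) ≠ 0 := by simpa using hξ
  rw [profile]
  push_cast
  field_simp
  ring

/-- Both decay factors of the profile are weakened to the common rate `α/2`, which affects constants
but not powers of `t`. -/
lemma exp_heat_le {α r t : ℝ} (hα : 0 < α) (ht : 0 ≤ t) :
    Real.exp (-α * r ^ 2 * t) ≤ Real.exp (-(α / 2) * r ^ 2 * t) := by
  have : 0 ≤ α * r ^ 2 * t := by positivity
  gcongr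
  linarith

lemma exp_damping_le {α β r t : ℝ} (hβ : 0 ≤ β) (ht : 0 ≤ t) :
    Real.exp (-(α + β) * r ^ 2 * t / 2) ≤ Real.exp (-(α / 2) * r ^ 2 * t) := by
  have : 0 ≤ β * r ^ 2 * t := by positivity
  gcongr
  linarith

/-- The contraction `ξ·P` and the sine term both carry a factor `|ξ|`, which offsets the division by
`|ξ|`. This serves the high frequencies. -/
lemma norm_profile_le {α β γ : ℝ} (hα : 0 < α) (hβ : 0 ≤ β) {ξ : Sp n} (hξ : ξ ≠ 0)
    {P : Fin n → ℝ} {Q S t : ℝ} (ht : 0 ≤ t) (hP : ∀ k, |P k| ≤ S) (hQ : |Q| ≤ S) (j : Fin n) :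
    ‖profile α β γ P Q t ξ j‖ ≤ (2 + 2 * n) * (Real.exp (-(α / 2) * ‖ξ‖ ^ 2 * t) * S) := by
  have hr : 0 < ‖ξ‖ := norm_pos_iff.2 hξ
  have hS : 0 ≤ S := (abs_nonneg Q).trans hQ
  have hp : ‖∑ k, (ξ k : ℂ) * P k‖ ≤ n * (‖ξ‖ * S) :=
    norm_sum_coord_mul_le fun k => by rw [Complex.norm_real]; exact hP k
  have hQ' : ‖(Q : ℂ)‖ ≤ S := by rwa [Complex.norm_real]
  set p := ∑ k, (ξ k : ℂ) * P k
  set e := Real.exp (-(α / 2) * ‖ξ‖ ^ 2 * t) with he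
  have h1 : ‖(P j : ℂ) - ξ j * p / (‖ξ‖ : ℂ) ^ 2‖ ≤ S + n * S := by
    refine (norm_sub_le _ _).trans (add_le_add ?_ ((norm_coord_mul_div_le hξ j p).trans ?_))
    · rw [Complex.norm_real]; exact hP j
    · rw [div_le_iff₀ hr]; linarith
  have h2 : ‖(Real.cos (γ * t * ‖ξ‖) : ℂ) * p - Complex.I * ‖ξ‖ * Real.sin (γ * t * ‖ξ‖) * Q‖
      ≤ (n * S + S) * ‖ξ‖ := by
    refine (norm_sub_le _ _).trans ?_
    rw [norm_mul, norm_mul, norm_mul, norm_mul, Complex.norm_I, Complex.norm_real, Complex.norm_real,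
      Complex.norm_real, norm_norm]
    calc _ ≤ 1 * (n * (‖ξ‖ * S)) + 1 * ‖ξ‖ * 1 * S := by
          gcongr
          · exact Real.abs_cos_le_one _
          · exact Real.abs_sin_le_one _
      _ = _ := by ring
  rw [profile_eq hξ]
  refine (norm_add_le _ _).trans ?_
  have h3 := norm_coord_mul_div_le hξ j ((Real.exp (-(α + β) * ‖ξ‖ ^ 2 * t / 2) : ℂ) *
        (Real.cos (γ * t * ‖ξ‖) * p - Complex.I * ‖ξ‖ * Real.sin (γ * t * ‖ξ‖) * Q))
  have h4 : ‖(Real.exp (-(α + β) * ‖ξ‖ ^ 2 * t / 2) : ℂ) *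
        (Real.cos (γ * t * ‖ξ‖) * p - Complex.I * ‖ξ‖ * Real.sin (γ * t * ‖ξ‖) * Q)‖ / ‖ξ‖
        ≤ e * (n * S + S) := by
    rw [div_le_iff₀ hr, norm_mul, Complex.norm_real, Real.norm_eq_abs, Real.abs_exp, mul_assoc e]
    exact mul_le_mul (exp_damping_le hβ ht) h2 (norm_nonneg _) (Real.exp_nonneg _)
  have h5 : ‖(Real.exp (-α * ‖ξ‖ ^ 2 * t) : ℂ) * (P j - ξ j * p / (‖ξ‖ : ℂ) ^ 2)‖
      ≤ e * (S + n * S) := by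
    rw [norm_mul, Complex.norm_real, Real.norm_eq_abs, Real.abs_exp]
    exact mul_le_mul (exp_heat_le hα ht) h1 (norm_nonneg _) (Real.exp_nonneg _)
  calc _ ≤ e * (S + n * S) + e * (n * S + S) := add_le_add h5 (h3.trans h4)
    _ = _ := by ring

/-- The constant of the low-frequency estimate. -/
def lowConst (n : ℕ) (α β γ : ℝ) : ℝ :=
  1 + n + (n + n * ((α + β) ^ 2 / (4 * γ)) + n * (α + β) / γ + 2 + (α + β) / (2 * γ)
    + (α + β) ^ 2 / (4 * γ))

/-- The transversal error comes from the data alone and is `O(|ξ|)`. The longitudinal error is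
quadratic in `|ξ|` up to the factor `1 + |ξ|²t`, and reconstructing the velocity costs one power. -/
lemma IsModeSolution.norm_sub_profile_le {α β γ : ℝ} {ξ : Sp n} {ρ : ℝ → ℂ} {v : ℝ → Fin n → ℂ}
    (h : IsModeSolution α β γ ξ ρ v) (hα : 0 < α) (hβ : 0 ≤ β) (hγ : 0 < γ) (hξ : ξ ≠ 0)
    (hlow : (α + β) * ‖ξ‖ ≤ γ) {P : Fin n → ℝ} {Q S t : ℝ} (ht : 0 ≤ t) (hP : ∀ k, |P k| ≤ S)
    (hQ : |Q| ≤ S) (hv : ∀ k, ‖v 0 k‖ ≤ S) (hvP : ∀ k, ‖v 0 k - P k‖ ≤ ‖ξ‖ * S)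
    (hρQ : ‖ρ 0 - Q‖ ≤ ‖ξ‖ * S) (j : Fin n) :
    ‖v t j - profile α β γ P Q t ξ j‖ ≤ lowConst n α β γ *
      (‖ξ‖ * (1 + ‖ξ‖ ^ 2 * t) * Real.exp (-(α / 2) * ‖ξ‖ ^ 2 * t) * S) := by
  have hr : 0 < ‖ξ‖ := norm_pos_iff.2 hξ
  have hS : 0 ≤ S := (abs_nonneg Q).trans hQ
  have hν : 0 < α + β := by linarith
  obtain ⟨ω, hω1, hω2, hω3⟩ := exists_dispersion hν hγ hr hlow
  have hω0 : ω ≠ 0 := (lt_of_lt_of_le (by positivity) hω1).ne'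
  have hw := h.longitudinal_eq hω0 hω2 t
  have hz := h.transversal_eq hξ t j
  have hwp : ‖∑ k, (ξ k : ℂ) * (v 0 k - P k)‖ ≤ n * (‖ξ‖ * (‖ξ‖ * S)) := norm_sum_coord_mul_le hvP
  simp only [mul_sub, Finset.sum_sub_distrib] at hwp
  have hp : ‖∑ k, (ξ k : ℂ) * P k‖ ≤ n * (‖ξ‖ * S) :=
    norm_sum_coord_mul_le fun k => by rw [Complex.norm_real]; exact hP k
  have hw0 : ‖∑ k, (ξ k : ℂ) * v 0 k‖ ≤ n * (‖ξ‖ * S) := norm_sum_coord_mul_le hv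
  rw [profile_eq hξ]
  set p := ∑ k, (ξ k : ℂ) * P k
  set w₀ := ∑ k, (ξ k : ℂ) * v 0 k
  set w := ∑ k, (ξ k : ℂ) * v t k
  set e := Real.exp (-(α / 2) * ‖ξ‖ ^ 2 * t) with he
  have hD := norm_oscillation_sub_le (N := n) (w := w₀) (p := p) (q := ρ 0) hν hγ hr hlow ht hS
    (Nat.cast_nonneg n) hω1 hω3 (by linarith) (by linarith) (by linarith) hQ hρQ
  set K := n + n * ((α + β) ^ 2 / (4 * γ)) + n * (α + β) / γ + 2 + (α + β) / (2 * γ)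
    + (α + β) ^ 2 / (4 * γ) with hK
  have hsplit : v t j - (Real.exp (-α * ‖ξ‖ ^ 2 * t) * (P j - ξ j * p / (‖ξ‖ : ℂ) ^ 2)
      + ξ j * (Real.exp (-(α + β) * ‖ξ‖ ^ 2 * t / 2) *
        (Real.cos (γ * t * ‖ξ‖) * p
          - Complex.I * ‖ξ‖ * Real.sin (γ * t * ‖ξ‖) * Q)) / (‖ξ‖ : ℂ) ^ 2)
      = Real.exp (-α * ‖ξ‖ ^ 2 * t) * ((v 0 j - P j) - ξ j * (w₀ - p) / (‖ξ‖ : ℂ) ^ 2)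
      + ξ j * (Real.exp (-(α + β) * ‖ξ‖ ^ 2 * t / 2) *
        (Real.cos (ω * t) * w₀ + Real.sin (ω * t) / ω *
          (-(((α + β : ℝ) : ℂ) * (‖ξ‖ : ℂ) ^ 2 / 2 * w₀)
          - Complex.I * γ * (‖ξ‖ : ℂ) ^ 2 * ρ 0) - Real.cos (γ * t * ‖ξ‖) * p
        + Complex.I * ‖ξ‖ * Real.sin (γ * t * ‖ξ‖) * Q)) / (‖ξ‖ : ℂ) ^ 2 := by
    rw [eq_add_of_sub_eq hz, hw]
    push_cast
    ring
  rw [hsplit]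
  refine (norm_add_le _ _).trans ?_
  have h1 : ‖(Real.exp (-α * ‖ξ‖ ^ 2 * t) : ℂ) *
      ((v 0 j - P j) - ξ j * (w₀ - p) / (‖ξ‖ : ℂ) ^ 2)‖ ≤ e * ((1 + n) * (‖ξ‖ * S)) := by
    rw [norm_mul, Complex.norm_real, Real.norm_eq_abs, Real.abs_exp]
    refine mul_le_mul (exp_heat_le hα ht) ?_ (norm_nonneg _) (Real.exp_nonneg _)
    have : ‖(ξ j : ℂ) * (w₀ - p) / (‖ξ‖ : ℂ) ^ 2‖ ≤ n * (‖ξ‖ * S) := by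
      refine (norm_coord_mul_div_le hξ j _).trans ?_
      rw [div_le_iff₀ hr]
      linarith
    linarith [norm_sub_le (v 0 j - P j) ((ξ j : ℂ) * (w₀ - p) / (‖ξ‖ : ℂ) ^ 2), hvP j]
  have h2 : ∀ D : ℂ, ‖D‖ ≤ K * (‖ξ‖ ^ 2 * (1 + ‖ξ‖ ^ 2 * t) * S) →
      ‖(ξ j : ℂ) * (Real.exp (-(α + β) * ‖ξ‖ ^ 2 * t / 2) * D) / (‖ξ‖ : ℂ) ^ 2‖
      ≤ e * (K * (‖ξ‖ * (1 + ‖ξ‖ ^ 2 * t) * S)) := by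
    intro D hD
    refine (norm_coord_mul_div_le hξ j _).trans ?_
    rw [div_le_iff₀ hr, norm_mul, Complex.norm_real, Real.norm_eq_abs, Real.abs_exp, mul_assoc e]
    refine mul_le_mul (exp_damping_le hβ ht) (hD.trans (le_of_eq ?_)) (norm_nonneg _)
      (Real.exp_nonneg _)
    ring
  refine (add_le_add h1 (h2 _ hD)).trans ?_
  have h3 : (1 + n) * (‖ξ‖ * S) ≤ (1 + n) * (‖ξ‖ * (1 + ‖ξ‖ ^ 2 * t) * S) := by
    have : 0 ≤ ‖ξ‖ ^ 2 * t := by positivity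
    gcongr
    nlinarith
  have h4 : e * ((1 + n) * (‖ξ‖ * S)) ≤ e * ((1 + n) * (‖ξ‖ * (1 + ‖ξ‖ ^ 2 * t) * S)) := by gcongr
  rw [lowConst, ← hK]
  linarith

/-! ### High-frequency energy estimate -/

/-- Exponential decay of the modes away from frequency zero. -/
lemma IsModeSolution.energy_decay {α β γ δ κ : ℝ} {ξ : Sp n} {ρ : ℝ → ℂ} {v : ℝ → Fin n → ℂ}
    (h : IsModeSolution α β γ ξ ρ v) (hα : 0 < α) (hβ : 0 ≤ β) (hγ : 0 < γ) (hδ : 0 < δ)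
    (hξ : δ ≤ ‖ξ‖) (hκ : 0 < κ) (hκ1 : κ ≤ δ) (hκ2 : κ * γ ≤ α * δ ^ 2 / 2)
    (hκ3 : κ * (α + β) ^ 2 / (2 * γ) ≤ α / 2) {η : ℝ} (hη1 : 3 / 2 * η ≤ α * δ ^ 2)
    (hη2 : 3 / 2 * η ≤ κ * γ / 2) (hη : 0 ≤ η) {t : ℝ} (ht : 0 ≤ t) :
    ∑ k, ‖v t k‖ ^ 2 + ‖ρ t‖ ^ 2
      ≤ 3 * (Real.exp (-η * t) * (∑ k, ‖v 0 k‖ ^ 2 + ‖ρ 0‖ ^ 2)) := by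
  have hr : 0 < ‖ξ‖ := hδ.trans_le hξ
  set r := ‖ξ‖ with hrdef
  set w : ℝ → ℂ := fun s => ∑ k, ξ k * v s k with hw
  set N : ℝ → ℝ := fun s => ∑ k, ‖v s k‖ ^ 2 with hN
  set R : ℝ → ℝ := fun s => ‖ρ s‖ ^ 2 with hR
  -- The energy `N + R` dissipates only velocity. The derivative of `X`, the imaginary part of `conj
  -- ρ * w`, contains `-γr²R` and so supplies the missing damping of the density.
  set X : ℝ → ℝ := fun s => (ρ s).re * (w s).im - (ρ s).im * (w s).re with hX
  have hre : ∀ {f : ℝ → ℂ} {f' : ℂ} {s : ℝ}, HasDerivAt f f' s →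
      HasDerivAt (fun s => (f s).re) f'.re s := fun hf =>
    Complex.reCLM.hasFDerivAt.comp_hasDerivAt _ hf
  have him : ∀ {f : ℝ → ℂ} {f' : ℂ} {s : ℝ}, HasDerivAt f f' s →
      HasDerivAt (fun s => (f s).im) f'.im s := fun hf =>
    Complex.imCLM.hasFDerivAt.comp_hasDerivAt _ hf
  have hnsq : ∀ {f : ℝ → ℂ} {f' : ℂ} {s : ℝ}, HasDerivAt f f' s →
      HasDerivAt (fun s => ‖f s‖ ^ 2) (2 * ((f s).re * f'.re + (f s).im * f'.im)) s := by
    intro f f' s hf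
    have h1 : (fun s => ‖f s‖ ^ 2) = fun s => (f s).re * (f s).re + (f s).im * (f s).im := by
      funext s
      rw [Complex.sq_norm, Complex.normSq_apply]
    rw [h1]
    refine (((hre hf).mul (hre hf)).add ((him hf).mul (him hf))).congr_deriv ?_
    ring
  have hwd : ∀ s, HasDerivAt w (-((α + β) * (r : ℂ) ^ 2 * w s)
    - Complex.I * γ * (r : ℂ) ^ 2 * ρ s) s := h.longitudinal
  have hρd : ∀ s, HasDerivAt ρ (-(Complex.I * γ * w s)) s := h.density
  have hwre : ∀ s, (w s).re = ∑ k, ξ k * (v s k).re := fun s => by simp [hw]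
  have hwim : ∀ s, (w s).im = ∑ k, ξ k * (v s k).im := fun s => by simp [hw]
  have hNR : ∀ s, HasDerivAt (fun s => N s + R s)
      (-(2 * α * r ^ 2 * N s) - 2 * β * ‖w s‖ ^ 2) s := by
    intro s
    have h1 := (HasDerivAt.fun_sum (u := Finset.univ) (fun k _ => hnsq (h.velocity s k))).add
      (hnsq (hρd s))
    refine h1.congr_deriv ?_
    have h2 : ∀ k, 2 * ((v s k).re * (-(α * (r : ℂ) ^ 2 * v s k) - β * ξ k * w s
          - Complex.I * γ * ξ k * ρ s).re + (v s k).im * (-(α * (r : ℂ) ^ 2 * v s k)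
          - β * ξ k * w s - Complex.I * γ * ξ k * ρ s).im)
        = -(2 * α * r ^ 2) * ‖v s k‖ ^ 2
          + (-(2 * β * (w s).re) + 2 * γ * (ρ s).im) * (ξ k * (v s k).re)
          + (-(2 * β * (w s).im) - 2 * γ * (ρ s).re) * (ξ k * (v s k).im) := by
      intro k
      rw [Complex.sq_norm, Complex.normSq_apply]
      simp [← Complex.ofReal_pow]
      ring
    rw [Finset.sum_congr rfl fun k _ => h2 k, Finset.sum_add_distrib, Finset.sum_add_distrib,
      ← Finset.mul_sum, ← Finset.mul_sum, ← Finset.mul_sum, ← hwre, ← hwim, Complex.sq_norm (w s),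
      Complex.normSq_apply]
    simp
    ring
  have hXd : ∀ s, HasDerivAt X (γ * ‖w s‖ ^ 2 - (α + β) * r ^ 2 * X s - γ * r ^ 2 * R s) s := by
    intro s
    refine (((hre (hρd s)).mul (him (hwd s))).sub ((him (hρd s)).mul (hre (hwd s)))).congr_deriv ?_
    simp only [hX, hR]
    rw [Complex.sq_norm (w s), Complex.sq_norm (ρ s), Complex.normSq_apply, Complex.normSq_apply]
    simp [← Complex.ofReal_pow]
    ring
  have hwN : ∀ s, ‖w s‖ ^ 2 ≤ r ^ 2 * N s := by
    intro s
    have h1 := Finset.sum_mul_sq_le_sq_mul_sq Finset.univ (fun k => ξ k) (fun k => (v s k).re)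
    have h2 := Finset.sum_mul_sq_le_sq_mul_sq Finset.univ (fun k => ξ k) (fun k => (v s k).im)
    rw [← hwre, sum_sq_eq_norm_sq] at h1
    rw [← hwim, sum_sq_eq_norm_sq] at h2
    have h3 : N s = ∑ k, (v s k).re ^ 2 + ∑ k, (v s k).im ^ 2 := by
      rw [← Finset.sum_add_distrib]
      refine Finset.sum_congr rfl fun k _ => ?_
      rw [Complex.sq_norm, Complex.normSq_apply]
      ring
    rw [Complex.sq_norm, Complex.normSq_apply, h3, mul_add]
    nlinarith
  have hN0 : ∀ s, 0 ≤ N s := fun s => Finset.sum_nonneg fun k _ => by positivity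
  have hR0 : ∀ s, 0 ≤ R s := fun s => by positivity
  have hXsq : ∀ s, X s ^ 2 ≤ R s * ‖w s‖ ^ 2 := by
    intro s
    simp only [hX, hR]
    rw [Complex.sq_norm (w s), Complex.sq_norm (ρ s), Complex.normSq_apply, Complex.normSq_apply]
    nlinarith [sq_nonneg ((ρ s).re * (w s).re + (ρ s).im * (w s).im)]
  set L : ℝ → ℝ := fun s => N s + R s + κ / r ^ 2 * X s with hL
  -- As `κ ≤ δ ≤ r`, the functional `L` lies between 1/2 and 3/2 of the energy; hence the factor 3
  -- in the conclusion and the 3/2 in the conditions on `η`.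
  have hXabs : ∀ s, |κ / r ^ 2 * X s| ≤ (N s + R s) / 2 := by
    intro s
    have h1 : |X s| ≤ r * ((N s + R s) / 2) := by
      refine abs_le_of_sq_le_sq ?_ (by have := hN0 s; have := hR0 s; positivity)
      calc X s ^ 2 ≤ R s * ‖w s‖ ^ 2 := hXsq s
        _ ≤ R s * (r ^ 2 * N s) := mul_le_mul_of_nonneg_left (hwN s) (hR0 s)
        _ = r ^ 2 * (N s * R s) := by ring
        _ ≤ r ^ 2 * ((N s + R s) / 2) ^ 2 := by
          gcongr
          nlinarith [sq_nonneg (N s - R s)]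
        _ = _ := by ring
    have h2 : κ / r ^ 2 * r ≤ 1 := by
      rw [show κ / r ^ 2 * r = κ / r by field_simp, div_le_one hr]
      exact hκ1.trans hξ
    rw [abs_mul, abs_of_pos (by positivity : 0 < κ / r ^ 2)]
    calc κ / r ^ 2 * |X s| ≤ κ / r ^ 2 * (r * ((N s + R s) / 2)) := by gcongr
      _ = κ / r ^ 2 * r * ((N s + R s) / 2) := by ring
      _ ≤ 1 * ((N s + R s) / 2) := by
        have := hN0 s
        have := hR0 s
        gcongr
      _ = _ := one_mul _
  have hcross : ∀ s, -(κ * (α + β) * X s) ≤ κ * γ / 2 * R s + α / 2 * r ^ 2 * N s := by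
    intro s
    -- Young's inequality, weighted so that half of the density damping survives; `hκ3` charges the
    -- rest to the viscosity.
    have h1 : |(α + β) * X s| ≤ γ / 2 * R s + (α + β) ^ 2 / (2 * γ) * ‖w s‖ ^ 2 := by
      refine abs_le_of_sq_le_sq ?_ (by have := hR0 s; positivity)
      have h2 : γ / 2 * R s * ((α + β) ^ 2 / (2 * γ) * ‖w s‖ ^ 2)
          = (α + β) ^ 2 * (R s * ‖w s‖ ^ 2) / 4 := by field_simp; ring
      have h3 := mul_le_mul_of_nonneg_left (hXsq s) (sq_nonneg (α + β))
      nlinarith [sq_nonneg (γ / 2 * R s - (α + β) ^ 2 / (2 * γ) * ‖w s‖ ^ 2)]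
    have h4 : κ * ((α + β) ^ 2 / (2 * γ) * ‖w s‖ ^ 2) ≤ α / 2 * (r ^ 2 * N s) := by
      rw [← mul_assoc, ← mul_div_assoc]
      exact mul_le_mul hκ3 (hwN s) (by positivity) (by positivity)
    have h5 := mul_le_mul_of_nonneg_left ((neg_le_abs _).trans h1) hκ.le
    nlinarith
  have hLd : ∀ s, HasDerivAt L (-(2 * α * r ^ 2 * N s) - 2 * β * ‖w s‖ ^ 2
      + κ / r ^ 2 * (γ * ‖w s‖ ^ 2 - (α + β) * r ^ 2 * X s - γ * r ^ 2 * R s)) s := fun s =>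
    (hNR s).add ((hXd s).const_mul _)
  have hrδ : δ ^ 2 ≤ r ^ 2 := pow_le_pow_left₀ hδ.le hξ 2
  -- Of the viscous dissipation `2αr²N`, a quarter pays for the cross term and a quarter for
  -- `κγ|w|²/r²` (by `hκ2`). The remaining `αr²N` and `κγR/2` dominate `ηL`.
  have hLle : ∀ s, -(2 * α * r ^ 2 * N s) - 2 * β * ‖w s‖ ^ 2
      + κ / r ^ 2 * (γ * ‖w s‖ ^ 2 - (α + β) * r ^ 2 * X s - γ * r ^ 2 * R s) ≤ -η * L s := by
    intro s
    have e1 : κ / r ^ 2 * (γ * ‖w s‖ ^ 2 - (α + β) * r ^ 2 * X s - γ * r ^ 2 * R s)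
        = κ * γ * (‖w s‖ ^ 2 / r ^ 2) - κ * (α + β) * X s - κ * γ * R s := by field_simp
    have e2 : ‖w s‖ ^ 2 / r ^ 2 ≤ N s := by
      rw [div_le_iff₀ (by positivity), mul_comm]
      exact hwN s
    have e3 : κ * γ * (‖w s‖ ^ 2 / r ^ 2) ≤ α * r ^ 2 / 2 * N s := by
      refine mul_le_mul (hκ2.trans ?_) e2 (by positivity) (by positivity)
      gcongr
    have e4 : 0 ≤ 2 * β * ‖w s‖ ^ 2 := by positivity
    have e5 : 3 / 2 * η * N s ≤ α * r ^ 2 * N s :=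
      mul_le_mul_of_nonneg_right (hη1.trans (by gcongr)) (hN0 s)
    have e6 : 3 / 2 * η * R s ≤ κ * γ / 2 * R s := mul_le_mul_of_nonneg_right hη2 (hR0 s)
    have e7 : η * L s ≤ η * (3 / 2 * (N s + R s)) := by
      refine mul_le_mul_of_nonneg_left ?_ hη
      have := (abs_le.1 (hXabs s)).2
      simp only [hL]
      linarith
    rw [e1]
    linarith [hcross s]
  have hanti : Antitone fun s => Real.exp (η * s) * L s := by
    refine antitone_of_hasDerivAt_nonpos (fun s => ((((hasDerivAt_id s).const_mul η).exp).mul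
      (hLd s))) fun s => ?_
    simp only [id_eq, mul_one, Pi.zero_apply]
    have := mul_le_mul_of_nonneg_left (hLle s) (Real.exp_nonneg (η * s))
    linarith
  have hfin := hanti ht
  simp only [mul_zero, Real.exp_zero, one_mul] at hfin
  have hLt : L t ≤ Real.exp (-η * t) * L 0 := by
    calc L t = Real.exp (-η * t) * (Real.exp (η * t) * L t) := by
          rw [← mul_assoc, ← Real.exp_add]
          simp
      _ ≤ _ := by gcongr
  have h1 := (abs_le.1 (hXabs t)).1
  have h2 := (abs_le.1 (hXabs 0)).2
  have h3 : L 0 ≤ 3 / 2 * (N 0 + R 0) := by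
    simp only [hL]
    linarith
  have h4 := mul_le_mul_of_nonneg_left h3 (Real.exp_nonneg (-η * t))
  have h5 : N t + R t ≤ 2 * L t := by
    simp only [hL]
    linarith
  change N t + R t ≤ 3 * (Real.exp (-η * t) * (N 0 + R 0))
  linarith

end LinNS

/-! ### Uniform bound over all frequencies, and the Gaussian moment -/

namespace LinNS

open Filter Topology Set

variable {n : ℕ}

/-- Half of the exponential absorbs the growing factor, since `1 + x ≤ (1 + 4/α)e^(αx/4)`; squaring
restores the rate `α/2`. -/
lemma sq_one_add_mul_exp_le {α x : ℝ} (hα : 0 < α) (hx : 0 ≤ x) :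
    ((1 + x) * Real.exp (-(α / 2) * x)) ^ 2 ≤ (1 + 4 / α) ^ 2 * Real.exp (-(α / 2) * x) := by
  have h1 : 1 + x ≤ (1 + 4 / α) * Real.exp (α / 4 * x) := by
    have e1 := Real.add_one_le_exp (α / 4 * x)
    have e2 : 1 ≤ Real.exp (α / 4 * x) := Real.one_le_exp (by positivity)
    have e3 : x ≤ 4 / α * Real.exp (α / 4 * x) := by
      rw [div_mul_eq_mul_div, le_div_iff₀ hα]
      linarith
    linarith
  calc ((1 + x) * Real.exp (-(α / 2) * x)) ^ 2
      ≤ ((1 + 4 / α) * Real.exp (α / 4 * x) * Real.exp (-(α / 2) * x)) ^ 2 := by gcongr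
    _ = (1 + 4 / α) ^ 2 * (Real.exp (α / 4 * x + -(α / 2) * x)
          * Real.exp (α / 4 * x + -(α / 2) * x)) := by rw [Real.exp_add]; ring
    _ = _ := by
      rw [← Real.exp_add]
      congr 2
      ring

lemma norm_sub_sq_le_two_mul (a b : ℂ) : ‖a - b‖ ^ 2 ≤ 2 * ‖a‖ ^ 2 + 2 * ‖b‖ ^ 2 := by
  have h := pow_le_pow_left₀ (norm_nonneg _) (norm_sub_le a b) 2
  nlinarith [sq_nonneg (‖a‖ - ‖b‖)]

/-- Split at `|ξ| = γ/(α+β)`. Below it, the comparison with the profile gives the Gaussian term.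
Above it, the solution and the profile are estimated separately, giving the exponential and the
Gaussian term respectively. -/
lemma exists_sum_sq_sub_profile_le (n : ℕ) {α β γ : ℝ} (hα : 0 < α) (hβ : 0 ≤ β) (hγ : 0 < γ) :
    ∃ C η : ℝ, 0 < C ∧ 0 < η ∧ ∀ {ξ : Sp n} {ρ : ℝ → ℂ} {v : ℝ → Fin n → ℂ} {P : Fin n → ℝ}
      {Q S t : ℝ}, IsModeSolution α β γ ξ ρ v → ξ ≠ 0 → 0 ≤ t → (∀ k, |P k| ≤ S) → |Q| ≤ S →
      (∀ k, ‖v 0 k‖ ≤ S) → (∀ k, ‖v 0 k - P k‖ ≤ ‖ξ‖ * S) → ‖ρ 0 - Q‖ ≤ ‖ξ‖ * S →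
      ∑ j, ‖v t j - profile α β γ P Q t ξ j‖ ^ 2
        ≤ C * S ^ 2 * (‖ξ‖ ^ 2 * Real.exp (-(α / 2) * ‖ξ‖ ^ 2 * t))
          + C * Real.exp (-η * t) * (∑ k, ‖v 0 k‖ ^ 2 + ‖ρ 0‖ ^ 2) := by
  have hν : 0 < α + β := by linarith
  set δ := γ / (α + β) with hδdef
  have hδ : 0 < δ := by positivity
  -- The largest value allowed by the three conditions of `energy_decay`; `η` below is chosen in the
  -- same way.
  set κ := min δ (min (α * δ ^ 2 / (2 * γ)) (α * γ / (α + β) ^ 2)) with hκdef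
  have hκ : 0 < κ := lt_min hδ (lt_min (by positivity) (by positivity))
  have hκ1 : κ ≤ δ := min_le_left _ _
  have hκ2 : κ * γ ≤ α * δ ^ 2 / 2 := by
    have : κ ≤ α * δ ^ 2 / (2 * γ) := (min_le_right _ _).trans (min_le_left _ _)
    rw [le_div_iff₀ (by positivity)] at this
    linarith
  have hκ3 : κ * (α + β) ^ 2 / (2 * γ) ≤ α / 2 := by
    have : κ ≤ α * γ / (α + β) ^ 2 := (min_le_right _ _).trans (min_le_right _ _)
    rw [le_div_iff₀ (by positivity)] at this
    rw [div_le_iff₀ (by positivity)]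
    linarith
  set η := min (2 / 3 * (α * δ ^ 2)) (κ * γ / 3) with hηdef
  have hη : 0 < η := lt_min (by positivity) (by positivity)
  have hη1 : 3 / 2 * η ≤ α * δ ^ 2 := by
    have : η ≤ 2 / 3 * (α * δ ^ 2) := min_le_left _ _
    linarith
  have hη2 : 3 / 2 * η ≤ κ * γ / 2 := by
    have : η ≤ κ * γ / 3 := min_le_right _ _
    linarith
  set C₁ := n * (lowConst n α β γ * (1 + 4 / α)) ^ 2 with hC₁
  set C₂ := 2 * (n * ((2 + 2 * n) / δ) ^ 2) with hC₂
  have hC₁0 : 0 ≤ C₁ := by positivity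
  have hC₂0 : 0 ≤ C₂ := by positivity
  refine ⟨C₁ + C₂ + 6, η, by positivity, hη, ?_⟩
  intro ξ ρ v P Q S t h hξ ht hP hQ hv hvP hρQ
  have hr : 0 < ‖ξ‖ := norm_pos_iff.2 hξ
  have hS : 0 ≤ S := (abs_nonneg Q).trans hQ
  set g := ‖ξ‖ ^ 2 * Real.exp (-(α / 2) * ‖ξ‖ ^ 2 * t) with hg
  set E := ∑ k, ‖v 0 k‖ ^ 2 + ‖ρ 0‖ ^ 2 with hE
  have hg0 : 0 ≤ g := by positivity
  have hE0 : 0 ≤ E := by positivity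
  have hgS : 0 ≤ S ^ 2 * g := by positivity
  have hηE : 0 ≤ Real.exp (-η * t) * E := by positivity
  have q1 := mul_nonneg hC₁0 hgS
  have q2 := mul_nonneg hC₂0 hgS
  have q3 := mul_nonneg hC₁0 hηE
  have q4 := mul_nonneg hC₂0 hηE
  rcases le_total ((α + β) * ‖ξ‖) γ with hlow | hhigh
  · have h1 : ∀ j, ‖v t j - profile α β γ P Q t ξ j‖ ^ 2
        ≤ (lowConst n α β γ * (1 + 4 / α)) ^ 2 * (S ^ 2 * g) := by
      intro j
      have h2 := h.norm_sub_profile_le hα hβ hγ hξ hlow ht hP hQ hv hvP hρQ j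
      have h3 := sq_one_add_mul_exp_le hα (x := ‖ξ‖ ^ 2 * t) (by positivity)
      rw [← mul_assoc] at h3
      calc ‖v t j - profile α β γ P Q t ξ j‖ ^ 2
          ≤ (lowConst n α β γ * (‖ξ‖ * (1 + ‖ξ‖ ^ 2 * t)
              * Real.exp (-(α / 2) * ‖ξ‖ ^ 2 * t) * S)) ^ 2 :=
            pow_le_pow_left₀ (norm_nonneg _) h2 2
        _ = (lowConst n α β γ) ^ 2 * S ^ 2 * ‖ξ‖ ^ 2 * ((1 + ‖ξ‖ ^ 2 * t)
              * Real.exp (-(α / 2) * ‖ξ‖ ^ 2 * t)) ^ 2 := by ring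
        _ ≤ (lowConst n α β γ) ^ 2 * S ^ 2 * ‖ξ‖ ^ 2 *
            ((1 + 4 / α) ^ 2 * Real.exp (-(α / 2) * ‖ξ‖ ^ 2 * t)) := by gcongr
        _ = _ := by rw [hg]; ring
    have h2 : ∑ j, ‖v t j - profile α β γ P Q t ξ j‖ ^ 2 ≤ C₁ * (S ^ 2 * g) := by
      refine (Finset.sum_le_sum fun j _ => h1 j).trans (le_of_eq ?_)
      simp [hC₁]
      ring
    linarith
  · have hδξ : δ ≤ ‖ξ‖ := by
      rw [hδdef, div_le_iff₀ hν]
      linarith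
    have h1 := h.energy_decay hα hβ hγ hδ hδξ hκ hκ1 hκ2 hκ3 hη1 hη2 hη.le ht
    have h2 : ∀ j, ‖profile α β γ P Q t ξ j‖ ^ 2 ≤ ((2 + 2 * n) / δ) ^ 2 * (S ^ 2 * g) := by
      intro j
      have e1 : Real.exp (-(α / 2) * ‖ξ‖ ^ 2 * t) ≤ 1 := by
        rw [Real.exp_le_one_iff]
        have : 0 ≤ α / 2 * ‖ξ‖ ^ 2 * t := by positivity
        linarith
      -- Inserting this factor turns the plain Gaussian into the moment used at low frequencies.
      have e2 : 1 ≤ (‖ξ‖ / δ) ^ 2 := one_le_pow₀ ((one_le_div hδ).2 hδξ)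
      calc ‖profile α β γ P Q t ξ j‖ ^ 2
          ≤ ((2 + 2 * n) * (Real.exp (-(α / 2) * ‖ξ‖ ^ 2 * t) * S)) ^ 2 :=
            pow_le_pow_left₀ (norm_nonneg _) (norm_profile_le hα hβ hξ ht hP hQ j) 2
        _ = (2 + 2 * n) ^ 2 * S ^ 2 * Real.exp (-(α / 2) * ‖ξ‖ ^ 2 * t)
              * (Real.exp (-(α / 2) * ‖ξ‖ ^ 2 * t) * 1) := by ring
        _ ≤ (2 + 2 * n) ^ 2 * S ^ 2 * Real.exp (-(α / 2) * ‖ξ‖ ^ 2 * t)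
              * (1 * (‖ξ‖ / δ) ^ 2) := by gcongr
        _ = _ := by rw [hg]; ring
    have h3 : ∑ j, ‖v t j - profile α β γ P Q t ξ j‖ ^ 2
        ≤ ∑ j, (2 * ‖v t j‖ ^ 2 + 2 * (((2 + 2 * n) / δ) ^ 2 * (S ^ 2 * g))) := by
      refine Finset.sum_le_sum fun j _ => ?_
      linarith [h2 j, norm_sub_sq_le_two_mul (v t j) (profile α β γ P Q t ξ j)]
    rw [Finset.sum_add_distrib, ← Finset.mul_sum] at h3
    have h4 : ∑ _j : Fin n, 2 * (((2 + 2 * (n : ℝ)) / δ) ^ 2 * (S ^ 2 * g)) = C₂ * (S ^ 2 * g) := by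
      simp [hC₂]
      ring
    rw [h4] at h3
    have h5 : 0 ≤ ‖ρ t‖ ^ 2 := by positivity
    linarith

/-- The Gaussian moment governing the algebraic decay rate. -/
lemma integrable_and_integral_normSq_mul_exp_le {b t : ℝ} (hb : 0 < b) (ht : 0 < t) :
    Integrable (fun ξ : Sp n => ‖ξ‖ ^ 2 * Real.exp (-b * ‖ξ‖ ^ 2 * t)) ∧
    ∫ ξ : Sp n, ‖ξ‖ ^ 2 * Real.exp (-b * ‖ξ‖ ^ 2 * t)
      ≤ 2 / b * (2 * Real.pi / b) ^ ((n : ℝ) / 2) * t ^ (-(n : ℝ) / 2 - 1) := by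
  have hbt : 0 < b * t / 2 := by positivity
  have hI : Integrable (fun ξ : Sp n => Real.exp (-(b * t / 2) * ‖ξ‖ ^ 2)) := by
    -- The integral of a nonintegrable function is 0 by convention, but the Gaussian formula gives a
    -- positive value.
    by_contra hcon
    have h1 := GaussianFourier.integral_rexp_neg_mul_sq_norm (V := Sp n) hbt
    rw [integral_undef hcon] at h1
    have : 0 < (Real.pi / (b * t / 2)) ^ ((Module.finrank ℝ (Sp n) : ℝ) / 2) := by positivity
    exact this.ne h1
  -- Half of the Gaussian absorbs `|ξ|²` at the price `2/(bt)`, the source of the extra `t⁻¹`.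
  have hle : ∀ ξ : Sp n, ‖ξ‖ ^ 2 * Real.exp (-b * ‖ξ‖ ^ 2 * t)
      ≤ 2 / (b * t) * Real.exp (-(b * t / 2) * ‖ξ‖ ^ 2) := by
    intro ξ
    have e1 := Real.add_one_le_exp (b * t / 2 * ‖ξ‖ ^ 2)
    have e2 : ‖ξ‖ ^ 2 ≤ 2 / (b * t) * Real.exp (b * t / 2 * ‖ξ‖ ^ 2) := by
      rw [div_mul_eq_mul_div, le_div_iff₀ (by positivity)]
      nlinarith
    calc _ ≤ 2 / (b * t) * Real.exp (b * t / 2 * ‖ξ‖ ^ 2) * Real.exp (-b * ‖ξ‖ ^ 2 * t) := by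
          gcongr
      _ = _ := by
        rw [mul_assoc, ← Real.exp_add]
        congr 2
        ring
  have hint : Integrable (fun ξ : Sp n => ‖ξ‖ ^ 2 * Real.exp (-b * ‖ξ‖ ^ 2 * t)) := by
    refine (hI.const_mul (2 / (b * t))).mono' (by fun_prop) (.of_forall fun ξ => ?_)
    rw [Real.norm_eq_abs, abs_of_nonneg (by positivity)]
    exact hle ξ
  refine ⟨hint, ?_⟩
  refine (integral_mono hint (hI.const_mul (2 / (b * t))) hle).trans (le_of_eq ?_)
  rw [integral_const_mul, GaussianFourier.integral_rexp_neg_mul_sq_norm hbt,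
    finrank_euclideanSpace_fin, show Real.pi / (b * t / 2) = 2 * Real.pi / b * t⁻¹ by
      field_simp, Real.mul_rpow (by positivity) (by positivity), Real.inv_rpow ht.le,
    ← Real.rpow_neg ht.le, Real.rpow_sub ht, Real.rpow_one, neg_div]
  field_simp

end LinNS

/-! ### The system on the Fourier side -/

namespace LinNS

open Filter Topology Set

variable {n : ℕ}

/-- The complexification of a real `L²` function. -/
def toC (f : L2 n) : CL2 n := Complex.ofRealCLM.compLp f

lemma coeFn_toC (f : L2 n) : toC f =ᵐ[volume] fun x => (f x : ℂ) :=
  Complex.ofRealCLM.coeFn_compLp f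

lemma pair_eq_pairL (f : L2 n) (φ : 𝓢(Sp n, ℂ)) : pair f φ = pairL φ (toC f) := by
  rw [pair, pairL_apply]
  apply integral_congr_ae
  filter_upwards [coeFn_toC f] with x hx
  rw [hx]

/-- The multiplication formula, inherited from the compatibility of the L² transform with that of
tempered distributions. -/
lemma pairL_fourier (f : CL2 n) (φ : 𝓢(Sp n, ℂ)) : pairL φ (𝓕 f) = pairL (𝓕 φ) f := by
  have h := DFunLike.congr_fun (Lp.fourier_toTemperedDistribution_eq f) φ
  rw [TemperedDistribution.fourier_apply, Lp.toTemperedDistribution_apply,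
    Lp.toTemperedDistribution_apply] at h
  simp only [pairL_apply]
  simpa [mul_comm] using h.symm

/-- The multiplier of `-∂_k` on the Fourier side, in the normalization with kernel `e^{-2πi x·ξ}`. -/
def coordMul (k : Fin n) (x : Sp n) : ℂ := -(2 * Real.pi * Complex.I) * x k

lemma coordMul_hasTemperateGrowth (k : Fin n) : (coordMul (n := n) k).HasTemperateGrowth := by
  have h2 : (fun x : Sp n => (x k : ℂ)).HasTemperateGrowth :=
    (Complex.ofRealCLM.comp (EuclideanSpace.proj (𝕜 := ℝ) k : Sp n →L[ℝ] ℝ)).hasTemperateGrowth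
  exact (Function.HasTemperateGrowth.const _).mul h2

/-- Testing the equations against `𝓕 φ` turns derivatives into multipliers acting on `φ`. -/
lemma pd_fourier (k : Fin n) (φ : 𝓢(Sp n, ℂ)) :
    pd k (𝓕 φ) = 𝓕 (SchwartzMap.smulLeftCLM ℂ (coordMul k) φ) := by
  rw [pd, SchwartzMap.lineDerivOp_fourier_eq]
  congr 1
  ext x
  have h : (inner ℝ · (EuclideanSpace.single k (1 : ℝ)) : Sp n → ℝ).HasTemperateGrowth :=
    ((innerSL ℝ).flip _).hasTemperateGrowth
  rw [SchwartzMap.smulLeftCLM_apply_apply (coordMul_hasTemperateGrowth k), smul_apply,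
    SchwartzMap.smulLeftCLM_apply_apply h]
  simp [coordMul, EuclideanSpace.inner_single_right]
  ring

/-- The matrix symbol of the system, in the normalization with kernel `e^{-2πi x·ξ}`. -/
def symbol (α β γ : ℝ) : Option (Fin n) → Option (Fin n) → Sp n → ℂ
  | none, none => fun _ => 0
  | none, some k => fun x => γ * coordMul k x
  | some j, none => fun x => γ * coordMul j x
  | some j, some k => fun x => (if j = k then α * ∑ l, coordMul l x * coordMul l x else 0)
      + β * (coordMul k x * coordMul j x)

lemma symbol_hasTemperateGrowth (α β γ : ℝ) (i j : Option (Fin n)) :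
    (symbol α β γ i j).HasTemperateGrowth := by
  have hc := coordMul_hasTemperateGrowth (n := n)
  have hconst : ∀ c : ℂ, (fun _ : Sp n => c).HasTemperateGrowth :=
    fun c => Function.HasTemperateGrowth.const c
  match i, j with
  | none, none => exact hconst 0
  | none, some k => exact (hconst γ).mul (hc k)
  | some j, none => exact (hconst γ).mul (hc j)
  | some j, some k =>
    refine Function.HasTemperateGrowth.add (f := fun x => if j = k then
      α * ∑ l, coordMul l x * coordMul l x else 0)
      (g := fun x => β * (coordMul k x * coordMul j x)) ?_ ((hconst β).mul ((hc k).mul (hc j)))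
    by_cases h : j = k
    · simp only [h, if_true]
      exact (hconst α).mul (Function.HasTemperateGrowth.sum fun l _ => (hc l).mul (hc l))
    · simp only [h, if_false]
      exact hconst 0

/-- `pairL` as a linear map in the test function. -/
def pairLin (f : CL2 n) : 𝓢(Sp n, ℂ) →ₗ[ℂ] ℂ where
  toFun φ := pairL φ f
  map_add' φ ψ := by
    simp only [pairL, ContinuousLinearMap.flip_apply]
    rw [← map_add]
    rfl
  map_smul' c φ := by
    simp only [pairL, ContinuousLinearMap.flip_apply, RingHom.id_apply]
    rw [← map_smul]
    rfl

/-- This and the next lemma match the rows of `symbol` with the right-hand sides that the weak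
equations acquire through `pd_fourier`. -/
lemma pairL_smulLeft_symbol_none (α β γ : ℝ) (φ : 𝓢(Sp n, ℂ)) (u : Option (Fin n) → CL2 n) :
    ∑ j, pairL (SchwartzMap.smulLeftCLM ℂ (symbol α β γ none j) φ) (u j)
      = γ * ∑ k, pairL (SchwartzMap.smulLeftCLM ℂ (coordMul k) φ) (u (some k)) := by
  have hs := symbol_hasTemperateGrowth (n := n) α β γ
  have h0 : SchwartzMap.smulLeftCLM ℂ (symbol α β γ none none) φ = 0 := by
    ext x
    rw [SchwartzMap.smulLeftCLM_apply_apply (hs _ _)]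
    simp [symbol]
  have h1 : ∀ k, SchwartzMap.smulLeftCLM ℂ (symbol α β γ none (some k)) φ
      = (γ : ℂ) • SchwartzMap.smulLeftCLM ℂ (coordMul k) φ := by
    intro k
    ext x
    rw [SchwartzMap.smulLeftCLM_apply_apply (hs _ _), smul_apply,
      SchwartzMap.smulLeftCLM_apply_apply (coordMul_hasTemperateGrowth k)]
    simp [symbol, mul_assoc]
  rw [Fintype.sum_option, h0]
  change pairLin (u none) 0 + ∑ k, pairLin (u (some k)) _ = _ * ∑ k, pairLin (u (some k)) _
  rw [map_zero, zero_add, Finset.mul_sum]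
  exact Finset.sum_congr rfl fun k _ => by rw [h1, map_smul, smul_eq_mul]

lemma pairL_smulLeft_symbol_some (α β γ : ℝ) (j : Fin n) (φ : 𝓢(Sp n, ℂ))
    (u : Option (Fin n) → CL2 n) :
    ∑ i, pairL (SchwartzMap.smulLeftCLM ℂ (symbol α β γ (some j) i) φ) (u i)
      = α * (∑ k, pairL (SchwartzMap.smulLeftCLM ℂ (coordMul k)
            (SchwartzMap.smulLeftCLM ℂ (coordMul k) φ)) (u (some j)))
        + β * (∑ k, pairL (SchwartzMap.smulLeftCLM ℂ (coordMul k)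
            (SchwartzMap.smulLeftCLM ℂ (coordMul j) φ)) (u (some k)))
        + γ * pairL (SchwartzMap.smulLeftCLM ℂ (coordMul j) φ) (u none) := by
  have hs := symbol_hasTemperateGrowth (n := n) α β γ
  have hc := coordMul_hasTemperateGrowth (n := n)
  have h0 : SchwartzMap.smulLeftCLM ℂ (symbol α β γ (some j) none) φ
      = (γ : ℂ) • SchwartzMap.smulLeftCLM ℂ (coordMul j) φ := by
    ext x
    rw [SchwartzMap.smulLeftCLM_apply_apply (hs _ _), smul_apply,
      SchwartzMap.smulLeftCLM_apply_apply (hc j)]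
    simp [symbol, mul_assoc]
  have h1 : ∀ k, SchwartzMap.smulLeftCLM ℂ (symbol α β γ (some j) (some k)) φ
      = (if j = k then (α : ℂ) • ∑ l, SchwartzMap.smulLeftCLM ℂ (coordMul l)
            (SchwartzMap.smulLeftCLM ℂ (coordMul l) φ) else 0)
        + (β : ℂ) • SchwartzMap.smulLeftCLM ℂ (coordMul k)
            (SchwartzMap.smulLeftCLM ℂ (coordMul j) φ) := by
    intro k
    ext x
    rw [SchwartzMap.smulLeftCLM_apply_apply (hs _ _)]
    by_cases h : j = k
    · simp only [h, if_true, symbol, add_apply, smul_apply, sum_apply,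
        SchwartzMap.smulLeftCLM_apply_apply (hc _), smul_eq_mul, add_mul, Finset.sum_mul,
        Finset.mul_sum, mul_assoc]
    · simp only [h, if_false, symbol, smul_apply, zero_add,
        SchwartzMap.smulLeftCLM_apply_apply (hc _), smul_eq_mul, mul_assoc]
  rw [Fintype.sum_option, h0]
  change pairLin (u none) _ + ∑ k, pairLin (u (some k)) _ = _ * (∑ k, pairLin (u (some j)) _)
    + _ * (∑ k, pairLin (u (some k)) _) + _ * pairLin (u none) _
  simp only [h1, map_add, map_smul, smul_eq_mul, Finset.sum_add_distrib, Finset.mul_sum]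
  have h2 : ∀ k, pairLin (u (some k)) (if j = k then (α : ℂ) • ∑ l, SchwartzMap.smulLeftCLM ℂ
      (coordMul l) (SchwartzMap.smulLeftCLM ℂ (coordMul l) φ) else 0)
      = if j = k then α * ∑ l, pairLin (u (some k)) (SchwartzMap.smulLeftCLM ℂ (coordMul l)
            (SchwartzMap.smulLeftCLM ℂ (coordMul l) φ)) else 0 := by
    intro k
    split_ifs <;> simp
  simp only [h2, Finset.sum_ite_eq, Finset.mem_univ, if_true, Finset.mul_sum]
  ring

/-- The Fourier transforms of the components of a solution, with the density at `none`. -/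
def transforms (ρ : L2 n) (v : Fin n → L2 n) : Option (Fin n) → CL2 n
  | none => 𝓕 (toC ρ)
  | some j => 𝓕 (toC (v j))

lemma quasiMeasurePreserving_const_smul {c : ℝ} (hc : c ≠ 0) :
    Measure.QuasiMeasurePreserving (fun ξ : Sp n => c • ξ) volume volume := by
  refine ⟨measurable_const_smul c, ?_⟩
  rw [Measure.map_addHaar_smul _ hc]
  exact Measure.smul_absolutelyContinuous

lemma ae_comp_const_smul {p : Sp n → Prop} {c : ℝ} (hc : c ≠ 0) (h : ∀ᵐ x, p x) :
    ∀ᵐ ξ : Sp n, p (c • ξ) :=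
  (quasiMeasurePreserving_const_smul hc).ae h

lemma continuous_fourier_toC : Continuous fun f : L2 n => (𝓕 (toC f) : CL2 n) :=
  (FourierTransform.fourierCLM ℂ (CL2 n)).continuous.comp
    (Complex.ofRealCLM.compLpL 2 volume).continuous

/-- Almost every Fourier mode of a solution solves the system of ordinary differential equations. -/
theorem IsSolution.ae_exists_isModeSolution {α β γ : ℝ} {ρ₀ : Sp n → ℝ} {v₀ : Fin n → Sp n → ℝ}
    {ρ : ℝ → L2 n} {v : ℝ → Fin n → L2 n} (h : IsSolution α β γ ρ₀ v₀ ρ v) {t : ℝ} (ht : 0 ≤ t) :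
    ∀ᵐ ξ : Sp n, ∃ (a : ℝ → ℂ) (b : ℝ → Fin n → ℂ), IsModeSolution α β γ ξ a b ∧
      a 0 = fourierL2 (ρ 0) ξ ∧ (∀ j, b 0 j = fourierL2 (v 0 j) ξ) ∧
      ∀ j, b t j = fourierL2 (v t j) ξ := by
  have key := ae_exists_pointwise_solution (symbol_hasTemperateGrowth α β γ)
    (u := fun s => transforms (ρ s) (v s)) ?_ ?_ ht
  · have hπ : (2 * Real.pi)⁻¹ ≠ 0 := by positivity
    -- Rescaling preserves null sets, and at `ξ/(2π)` each `coordMul k` becomes `-iξ_k`.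
    filter_upwards [ae_comp_const_smul hπ key] with ξ hξ
    obtain ⟨y, hy0, hyt, hy⟩ := hξ
    refine ⟨fun s => y s none, fun s j => y s (some j), ⟨fun s => ?_, fun s j => ?_⟩, hy0 none,
      fun j => hy0 (some j), fun j => hyt (some j)⟩
    · refine (hy s none).congr_deriv ?_
      have hπc : (Real.pi : ℂ) ≠ 0 := by exact_mod_cast Real.pi_ne_zero
      rw [Fintype.sum_option]
      simp only [symbol, coordMul, zero_mul, zero_add, Finset.mul_sum, PiLp.smul_apply,
        smul_eq_mul, ← Finset.sum_neg_distrib]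
      refine Finset.sum_congr rfl fun k _ => ?_
      push_cast
      field_simp
    · refine (hy s (some j)).congr_deriv ?_
      have hπc : (Real.pi : ℂ) ≠ 0 := by exact_mod_cast Real.pi_ne_zero
      have hc : ∀ k, coordMul k ((2 * Real.pi)⁻¹ • ξ) = -(Complex.I * ξ k) := by
        intro k
        simp only [coordMul, PiLp.smul_apply, smul_eq_mul]
        push_cast
        field_simp
      have hsq : ∑ l, (-(Complex.I * (ξ l : ℂ))) * (-(Complex.I * (ξ l : ℂ)))
          = -(‖ξ‖ : ℂ) ^ 2 := by
        have : ∑ k, (ξ k : ℂ) ^ 2 = (‖ξ‖ : ℂ) ^ 2 := by exact_mod_cast sum_sq_eq_norm_sq ξ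
        rw [← this, ← Finset.sum_neg_distrib]
        refine Finset.sum_congr rfl fun k _ => ?_
        linear_combination (ξ k : ℂ) ^ 2 * Complex.I_sq
      rw [Fintype.sum_option]
      simp only [symbol, hc, hsq, add_mul, Finset.sum_add_distrib, ite_mul, zero_mul,
        Finset.sum_ite_eq, Finset.mem_univ, if_true, Finset.mul_sum]
      have : ∀ k, (β : ℂ) * (-(Complex.I * ξ k) * -(Complex.I * ξ j)) * y s (some k)
          = -(β * ξ j * (ξ k * y s (some k))) := by
        intro k
        linear_combination β * ξ k * ξ j * y s (some k) * Complex.I_sq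
      rw [Finset.sum_congr rfl fun k _ => this k, Finset.sum_neg_distrib]
      ring
  · intro i
    match i with
    | none => exact continuous_fourier_toC.comp_continuousOn h.continuousOn_density
    | some j => exact continuous_fourier_toC.comp_continuousOn (h.continuousOn_velocity j)
  · intro t ht i φ
    match i with
    | none =>
      have h1 := h.continuity_equation t ht (𝓕 φ)
      simp only [pair_eq_pairL, pd_fourier, ← pairL_fourier] at h1
      rw [pairL_smulLeft_symbol_none]
      exact h1
    | some j =>
      have h1 := h.momentum_equation t ht j (𝓕 φ)
      simp only [pair_eq_pairL, pd_fourier, ← pairL_fourier] at h1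
      rw [pairL_smulLeft_symbol_some]
      exact h1

end LinNS

/-! ### Fourier transforms of the data -/

namespace LinNS

open Filter Topology Set
open scoped ENNReal

variable {n : ℕ}

/-- On `L¹ ∩ L²` the Plancherel transform is given by the Fourier integral. -/
lemma ae_fourier_toC_eq {f : L2 n} {f₀ : Sp n → ℝ} (hf : f =ᵐ[volume] f₀) (hi : Integrable f₀) :
    (𝓕 (toC f) : CL2 n) =ᵐ[volume] 𝓕 (fun x => (f₀ x : ℂ)) := by
  have hi' : Integrable (fun x => (f₀ x : ℂ)) := hi.ofReal
  have hcont : Continuous (𝓕 (fun x => (f₀ x : ℂ))) :=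
    VectorFourier.fourierIntegral_continuous Real.continuous_fourierChar
      (by exact continuous_inner) hi'
  -- Both transforms satisfy the multiplication formula, so they agree against every smooth
  -- compactly supported function.
  refine ae_eq_of_integral_contDiff_smul_eq
    ((Lp.memLp (𝓕 (toC f) : CL2 n)).locallyIntegrable (by norm_num)) hcont.locallyIntegrable ?_
  intro g hg hgc
  have hg1 : HasCompactSupport (Complex.ofRealCLM ∘ g) := hgc.comp_left rfl
  have hg2 : ContDiff ℝ _ (Complex.ofRealCLM ∘ g) := Complex.ofRealCLM.contDiff.comp hg
  set φ : 𝓢(Sp n, ℂ) := hg1.toSchwartzMap hg2 with hφ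
  have hφx : ∀ x, φ x = (g x : ℂ) := fun x => rfl
  have h1 : pairL φ (𝓕 (toC f)) = ∫ x, g x • (𝓕 (toC f) : CL2 n) x := by
    rw [pairL_apply]
    congr 1
    funext x
    rw [hφx, Complex.real_smul, mul_comm]
  rw [← h1, pairL_fourier, pairL_apply]
  have h2 := VectorFourier.integral_fourierIntegral_smul_eq_flip (L := innerₗ (Sp n))
    (μ := volume) (ν := volume) Real.continuous_fourierChar (by exact continuous_inner) hi' φ.integrable
  have h3 : ∫ x, g x • 𝓕 (fun x => (f₀ x : ℂ)) x = ∫ x, 𝓕 (fun x => (f₀ x : ℂ)) x • φ x := by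
    congr 1
    funext x
    rw [hφx, Complex.real_smul, smul_eq_mul, mul_comm]
  rw [h3]
  refine Eq.trans ?_ h2.symm
  rw [flip_innerₗ]
  apply integral_congr_ae
  filter_upwards [coeFn_toC f, hf] with x h4 h5
  rw [h4, h5]
  rfl

lemma ae_fourierL2_eq {f : L2 n} {f₀ : Sp n → ℝ} (hf : f =ᵐ[volume] f₀) (hi : Integrable f₀) :
    ∀ᵐ ξ : Sp n, fourierL2 f ξ = 𝓕 (fun x => (f₀ x : ℂ)) ((2 * Real.pi)⁻¹ • ξ) :=
  ae_comp_const_smul (by positivity) (ae_fourier_toC_eq hf hi)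

lemma integral_abs_le_norm11 {f : Sp n → ℝ} (hf : MemL11 f) : ∫ x, |f x| ≤ norm11 f := by
  refine integral_mono hf.1.abs hf.2 fun x => ?_
  have : 0 ≤ ‖x‖ * |f x| := by positivity
  simp only
  linarith

lemma norm11_nonneg (f : Sp n → ℝ) : 0 ≤ norm11 f := integral_nonneg fun x => by positivity

lemma abs_integral_le_norm11 {f : Sp n → ℝ} (hf : MemL11 f) : |∫ x, f x| ≤ norm11 f :=
  (abs_integral_le_integral_abs).trans (integral_abs_le_norm11 hf)

lemma norm_fourier_le_norm11 {f : Sp n → ℝ} (hf : MemL11 f) (w : Sp n) :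
    ‖𝓕 (fun x => (f x : ℂ)) w‖ ≤ norm11 f := by
  refine (VectorFourier.norm_fourierIntegral_le_integral_norm _ _ _ _ _).trans ?_
  simpa using integral_abs_le_norm11 hf

/-- Because `|e^(-ix·ξ) - 1| ≤ |x||ξ|`; this is where the weight in the norm of the data is needed.
-/
lemma norm_fourier_sub_integral_le {f : Sp n → ℝ} (hf : MemL11 f) (ξ : Sp n) :
    ‖𝓕 (fun x => (f x : ℂ)) ((2 * Real.pi)⁻¹ • ξ) - ((∫ x, f x : ℝ) : ℂ)‖ ≤ ‖ξ‖ * norm11 f := by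
  have hi' : Integrable (fun x => (f x : ℂ)) := hf.1.ofReal
  have hE : ∀ x : Sp n, -2 * Real.pi * inner ℝ x ((2 * Real.pi)⁻¹ • ξ) = -inner ℝ x ξ := by
    intro x
    rw [inner_smul_right]
    field_simp
  have h1 : 𝓕 (fun x => (f x : ℂ)) ((2 * Real.pi)⁻¹ • ξ)
      = ∫ x, Complex.exp (Complex.I * (-inner ℝ x ξ : ℝ)) * f x := by
    rw [Real.fourier_eq']
    congr 1
    funext x
    rw [hE, smul_eq_mul, mul_comm Complex.I]
  have hci : Integrable fun x => Complex.exp (Complex.I * (-inner ℝ x ξ : ℝ)) * f x := by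
    refine hi'.mono ((Continuous.aestronglyMeasurable (by fun_prop)).mul
      hi'.aestronglyMeasurable) (.of_forall fun x => ?_)
    rw [norm_mul, mul_comm Complex.I, Complex.norm_exp_ofReal_mul_I, one_mul]
  rw [h1, ← integral_complex_ofReal, ← integral_sub hci hi', norm11, ← integral_const_mul]
  refine norm_integral_le_of_norm_le (hf.2.const_mul _) (.of_forall fun x => ?_)
  rw [← sub_one_mul, norm_mul, Complex.norm_real, Real.norm_eq_abs, ← mul_assoc]
  gcongr
  refine (Real.norm_exp_I_mul_ofReal_sub_one_le).trans ?_
  rw [norm_neg]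
  refine (norm_inner_le_norm x ξ).trans ?_
  nlinarith [norm_nonneg x, norm_nonneg ξ]

lemma norm_toC (f : L2 n) : ‖toC f‖ = ‖f‖ := by
  rw [Lp.norm_def, Lp.norm_def]
  congr 1
  refine eLpNorm_congr_norm_ae ?_
  filter_upwards [coeFn_toC f] with x hx
  rw [hx, Complex.norm_real]

lemma integrable_and_integral_norm_sq (F : CL2 n) :
    Integrable (fun x => ‖F x‖ ^ 2) ∧ ∫ x, ‖F x‖ ^ 2 = ‖F‖ ^ 2 := by
  refine ⟨(memLp_two_iff_integrable_sq_norm (Lp.memLp F).1).1 (Lp.memLp F), ?_⟩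
  have h := L2.inner_def (𝕜 := ℂ) F F
  rw [inner_self_eq_norm_sq_to_K] at h
  have h2 : ∀ x, inner ℂ (F x) (F x) = ((‖F x‖ ^ 2 : ℝ) : ℂ) := fun x => by
    rw [inner_self_eq_norm_sq_to_K]
    push_cast
    rfl
  simp only [h2] at h
  rw [integral_complex_ofReal] at h
  refine Complex.ofReal_injective ?_
  rw [← h]
  simp

/-- Plancherel; the factor `(2π)^n` is the Jacobian of the frequency rescaling. -/
lemma integrable_and_integral_norm_sq_fourierL2 {f : L2 n} {f₀ : Sp n → ℝ}
    (hf : f =ᵐ[volume] f₀) :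
    Integrable (fun ξ => ‖fourierL2 f ξ‖ ^ 2) ∧
      ∫ ξ, ‖fourierL2 f ξ‖ ^ 2 = (2 * Real.pi) ^ n * norm2 f₀ ^ 2 := by
  obtain ⟨h1, h2⟩ := integrable_and_integral_norm_sq (𝓕 (toC f) : CL2 n)
  have hπ : (2 * Real.pi)⁻¹ ≠ 0 := by positivity
  refine ⟨(integrable_comp_smul_iff volume (fun x => ‖(𝓕 (toC f) : CL2 n) x‖ ^ 2) hπ).2 h1, ?_⟩
  have h3 := Measure.integral_comp_smul volume (fun x => ‖(𝓕 (toC f) : CL2 n) x‖ ^ 2)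
    (2 * Real.pi)⁻¹
  rw [finrank_euclideanSpace_fin, h2, Lp.norm_fourier_eq, norm_toC, Lp.norm_def,
    eLpNorm_congr_ae hf, inv_pow, inv_inv, abs_of_nonneg (by positivity), smul_eq_mul] at h3
  exact h3

lemma aestronglyMeasurable_fourierL2 (f : L2 n) : AEStronglyMeasurable (fourierL2 f) volume :=
  (Lp.aestronglyMeasurable (𝓕 (toC f) : CL2 n)).comp_quasiMeasurePreserving
    (quasiMeasurePreserving_const_smul (by positivity))

lemma measurable_profile (α β γ : ℝ) (P : Fin n → ℝ) (Q t : ℝ) (j : Fin n) :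
    Measurable fun ξ => profile α β γ P Q t ξ j := by
  unfold profile
  fun_prop

end LinNS

/-! ### Integration over frequencies -/

open LinNS in
theorem theorem1p2 (n : ℕ) (hn : 2 ≤ n) (α β γ : ℝ) (hα : 0 < α) (hβ : 0 ≤ β) (hγ : 0 < γ) :
    ∃ C η T : ℝ, 0 < C ∧ 0 < η ∧ 0 < T ∧
      ∀ (ρ₀ : LinNS.Sp n → ℝ) (v₀ : Fin n → LinNS.Sp n → ℝ),
        LinNS.MemL11 ρ₀ → MemLp ρ₀ 2 volume →
        (∀ j, LinNS.MemL11 (v₀ j)) → (∀ j, MemLp (v₀ j) 2 volume) →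
        ∀ (ρ : ℝ → LinNS.L2 n) (v : ℝ → Fin n → LinNS.L2 n),
          LinNS.IsSolution α β γ ρ₀ v₀ ρ v →
          ∀ t : ℝ, T ≤ t →
            Integrable (fun ξ => LinNS.errorSq α β γ ρ₀ v₀ (v t) t ξ) ∧
            ∫ ξ, LinNS.errorSq α β γ ρ₀ v₀ (v t) t ξ ≤
              C * ((∑ j, (∫ x, v₀ j x) ^ 2) + (∫ x, ρ₀ x) ^ 2
                  + (∑ j, LinNS.norm11 (v₀ j) ^ 2) + LinNS.norm11 ρ₀ ^ 2)
                * t ^ (-(n : ℝ) / 2 - 1)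
              + C * Real.exp (-η * t)
                * ((∑ j, LinNS.norm2 (v₀ j) ^ 2) + LinNS.norm2 ρ₀ ^ 2) := by
  obtain ⟨C₀, η, hC₀, hη, hmode⟩ := exists_sum_sq_sub_profile_le n hα hβ hγ
  set K := 2 / (α / 2) * (2 * Real.pi / (α / 2)) ^ ((n : ℝ) / 2) with hK
  have hK0 : 0 < K := by positivity
  -- The factor `2n + 2` comes from `S² ≤ (2n+2)X` (Cauchy–Schwarz), and `K` from the Gaussian
  -- moment with `b = α/2`.
  set C₁ := C₀ * ((2 * n + 2) * K) with hC₁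
  set C₂ := C₀ * (2 * Real.pi) ^ n with hC₂
  have hC₁0 : 0 < C₁ := by positivity
  have hC₂0 : 0 < C₂ := by positivity
  -- The value `T = 1` is arbitrary: only `t > 0` is used.
  refine ⟨C₁ + C₂, η, 1, by positivity, hη, one_pos, ?_⟩
  intro ρ₀ v₀ hρ₀ _ hv₀ _ ρ v hsol t ht
  have ht0 : 0 < t := by linarith
  -- One number dominating the masses, the transforms and the first-order differences of all
  -- components.
  set S := ∑ j, norm11 (v₀ j) + norm11 ρ₀ with hS
  have hsum0 : 0 ≤ ∑ j, norm11 (v₀ j) := Finset.sum_nonneg fun j _ => norm11_nonneg _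
  have hvS : ∀ k, norm11 (v₀ k) ≤ S := fun k => by
    have := Finset.single_le_sum (fun j _ => norm11_nonneg (v₀ j)) (Finset.mem_univ k)
    linarith [norm11_nonneg ρ₀]
  have hρS : norm11 ρ₀ ≤ S := by linarith
  set G : Sp n → ℝ := fun ξ => ‖ξ‖ ^ 2 * Real.exp (-(α / 2) * ‖ξ‖ ^ 2 * t) with hG
  set E : Sp n → ℝ := fun ξ => ∑ k, ‖fourierL2 (v 0 k) ξ‖ ^ 2 + ‖fourierL2 (ρ 0) ξ‖ ^ 2 with hE
  have hbound : ∀ᵐ ξ : Sp n, errorSq α β γ ρ₀ v₀ (v t) t ξ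
      ≤ C₀ * S ^ 2 * G ξ + C₀ * Real.exp (-η * t) * E ξ := by
    -- In positive dimension the origin, where the mode estimate does not apply, is a null set.
    have hne : ∀ᵐ ξ : Sp n, ξ ≠ 0 := by
      have : Nonempty (Fin n) := ⟨⟨0, by omega⟩⟩
      exact Measure.ae_ne volume 0
    filter_upwards [hsol.ae_exists_isModeSolution ht0.le, hne,
      ae_fourierL2_eq hsol.initial_density hρ₀.1,
      ae_all_iff.2 fun j => ae_fourierL2_eq (hsol.initial_velocity j) (hv₀ j).1]
      with ξ h1 h2 h3 h4
    obtain ⟨a, b, hab, ha0, hb0, hbt⟩ := h1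
    have key := hmode (P := fun k => ∫ x, v₀ k x) (Q := ∫ x, ρ₀ x) (S := S) hab h2 ht0.le
      (fun k => (abs_integral_le_norm11 (hv₀ k)).trans (hvS k))
      ((abs_integral_le_norm11 hρ₀).trans hρS)
      (fun k => by
        rw [hb0, h4]
        exact (norm_fourier_le_norm11 (hv₀ k) _).trans (hvS k))
      (fun k => by
        rw [hb0, h4]
        refine (norm_fourier_sub_integral_le (hv₀ k) ξ).trans ?_
        gcongr
        exact hvS k)
      (by
        rw [ha0, h3]
        refine (norm_fourier_sub_integral_le hρ₀ ξ).trans ?_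
        gcongr)
    simp only [hbt, hb0, ha0] at key
    exact key
  obtain ⟨hGi, hGle⟩ := integrable_and_integral_normSq_mul_exp_le (n := n) (half_pos hα) ht0
  have hρE := integrable_and_integral_norm_sq_fourierL2 hsol.initial_density
  have hvE := fun k => integrable_and_integral_norm_sq_fourierL2 (hsol.initial_velocity k)
  have hsE : Integrable fun ξ => ∑ k, ‖fourierL2 (v 0 k) ξ‖ ^ 2 :=
    integrable_finsetSum _ fun k _ => (hvE k).1
  have hEi : Integrable E := hsE.add hρE.1
  have hEint : ∫ ξ, E ξ = (2 * Real.pi) ^ n * (∑ j, norm2 (v₀ j) ^ 2 + norm2 ρ₀ ^ 2) := by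
    rw [hE, integral_add hsE hρE.1, integral_finsetSum _ fun k _ => (hvE k).1, hρE.2,
      Finset.sum_congr rfl fun k _ => (hvE k).2, ← Finset.mul_sum, mul_add]
  have hdom : Integrable fun ξ => C₀ * S ^ 2 * G ξ + C₀ * Real.exp (-η * t) * E ξ :=
    (hGi.const_mul _).add (hEi.const_mul _)
  have hmeas : AEStronglyMeasurable (fun ξ => errorSq α β γ ρ₀ v₀ (v t) t ξ) volume := by
    unfold errorSq
    refine Finset.aestronglyMeasurable_fun_sum _ fun j _ => ?_
    exact ((aestronglyMeasurable_fourierL2 (v t j)).sub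
      (measurable_profile _ _ _ _ _ _ j).aestronglyMeasurable).norm.pow 2
  have herr0 : ∀ ξ, 0 ≤ errorSq α β γ ρ₀ v₀ (v t) t ξ := fun ξ =>
    Finset.sum_nonneg fun j _ => by positivity
  have hint : Integrable (fun ξ => errorSq α β γ ρ₀ v₀ (v t) t ξ) := by
    refine hdom.mono' hmeas ?_
    filter_upwards [hbound] with ξ hξ
    rwa [Real.norm_eq_abs, abs_of_nonneg (herr0 ξ)]
  refine ⟨hint, (integral_mono_ae hint hdom hbound).trans ?_⟩
  rw [integral_add (hGi.const_mul _) (hEi.const_mul _), integral_const_mul, integral_const_mul,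
    hEint]
  set X := ∑ j, norm11 (v₀ j) ^ 2 + norm11 ρ₀ ^ 2 with hX
  set Y := ∑ j, norm2 (v₀ j) ^ 2 + norm2 ρ₀ ^ 2 with hY
  set Z := ∑ j, (∫ x, v₀ j x) ^ 2 + (∫ x, ρ₀ x) ^ 2 with hZ
  set τ := t ^ (-(n : ℝ) / 2 - 1) with hτ
  have hτ0 : 0 ≤ τ := by positivity
  have hX0 : 0 ≤ X := by positivity
  have hY0 : 0 ≤ Y := by positivity
  have hZ0 : 0 ≤ Z := by positivity
  have hSX : S ^ 2 ≤ (2 * n + 2) * X := by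
    have h1 := sq_sum_le_card_mul_sum_sq (s := Finset.univ) (f := fun j => norm11 (v₀ j))
    rw [Finset.card_univ, Fintype.card_fin] at h1
    have h2 : 0 ≤ ∑ j, norm11 (v₀ j) ^ 2 := by positivity
    have h3 : 0 ≤ (n : ℝ) * norm11 ρ₀ ^ 2 := by positivity
    rw [hS, hX]
    nlinarith [sq_nonneg (∑ j, norm11 (v₀ j) - norm11 ρ₀)]
  have hfirst : C₀ * S ^ 2 * ∫ ξ, G ξ ≤ C₁ * X * τ := by
    calc C₀ * S ^ 2 * ∫ ξ, G ξ ≤ C₀ * ((2 * n + 2) * X) * (K * τ) := by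
          refine mul_le_mul (by gcongr) hGle ?_ (by positivity)
          exact integral_nonneg fun ξ => by positivity
      _ = _ := by rw [hC₁]; ring
  have hsecond : C₀ * Real.exp (-η * t) * ((2 * Real.pi) ^ n * Y) = C₂ * Real.exp (-η * t) * Y := by
    rw [hC₂]
    ring
  rw [hsecond, show Z + ∑ j, norm11 (v₀ j) ^ 2 + norm11 ρ₀ ^ 2 = Z + X by rw [hX]; ring]
  have r1 : C₁ * X * τ ≤ (C₁ + C₂) * (Z + X) * τ := by
    gcongr <;> linarith
  have r2 : C₂ * Real.exp (-η * t) * Y ≤ (C₁ + C₂) * Real.exp (-η * t) * Y := by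
    gcongr
    linarith
  linarith

end
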